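/- Let $M$ be a compact connected (Hausdorff, boundaryless) smooth manifold of dimension $n$, and let $\rho$ be a smooth action of $\mathbb R^k$ on $M$ by diffeomorphisms, with generating vector fields $X_i(x)=\frac{d}{dt}\big|_{t=0}\rho(te_i)(x)$, $i=1,\dots,k$. Write $\mathcal E'(M)$ for the space of distributions on $M$, i.e. the continuous linear functionals on $C^\infty(M)$ with its $C^\infty$ topology. Call $D\in\mathcal E'(M)$ smooth if it is given by a smooth density $\mu$, $D(f)=\int_M f\,d\mu$. Let $X_i$ act on functions, and on distributions by the Lie derivative $(X_iD)(f)=-D(X_if)$, and let $L_\rho=\sum_{i=1}^k X_i^2$ be the leafwise Laplacian, so that $(L_\rho D)(f)=D(L_\rho f)$. Suppose that $L_\rho$ is globally hypoelliptic: every $u\in\mathcal E'(M)$ for which $L_\rho u$ is smooth is itself smooth. Then 1. $\rho$ preserves a smooth nowhere-vanishing volume density on $M$ (which may be taken positive); if $M$ is orientable, $\rho$ preserves a smooth nowhere-vanishing volume form (differential $n$-form); 2. the space of invariant distributions $$\bigcap_{i=1}^k\operatorname{Ker}X_i=\{D\in\mathcal E'(M): D(X_if)=0\ \text{for all } f\in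 C^\infty(M),\ i=1,\dots,k\}$$ is one-dimensional. -/

import Mathlib

open scoped Manifold ContDiff
open MeasureTheory

noncomputable section

namespace LeafwiseGH

section Manifold

variable {n : ℕ} {M : Type*} [TopologicalSpace M] [ChartedSpace (EuclideanSpace ℝ (Fin n)) M]

/-- The `C^∞` topology on the space of smooth functions: the coarsest topology for which, for every
chart `φ` and every order `m`, the map sending `f` to the `m`-th derivative of `f ∘ φ⁻¹` is
continuous for uniform convergence on the compact subsets of the domain of `φ⁻¹`. -/
instance smoothFunctionTopology : TopologicalSpace C^∞⟮𝓡 n, M; ℝ⟯ :=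
  ⨅ (c : M) (m : ℕ), TopologicalSpace.induced
    (fun f : C^∞⟮𝓡 n, M; ℝ⟯ =>
      UniformOnFun.ofFun
        {K | IsCompact K ∧ K ⊆ (chartAt (EuclideanSpace ℝ (Fin n)) c).target}
        (iteratedFDeriv ℝ m
          (fun y => f ((chartAt (EuclideanSpace ℝ (Fin n)) c).symm y))))
    inferInstance

variable (n M) in
/-- Distributions on a compact manifold: continuous linear functionals on the space of
smooth functions. -/
abbrev Distribution := C^∞⟮𝓡 n, M; ℝ⟯ →L[ℝ] ℝ

/-- The coordinate frame `(∂₁, …, ∂ₙ)` of the preferred chart `φ` at `c`, at the point `φ⁻¹ y`. -/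
def chartFrame (c : M) (y : EuclideanSpace ℝ (Fin n)) (j : Fin n) :
    TangentSpace (𝓡 n) ((chartAt (EuclideanSpace ℝ (Fin n)) c).symm y) :=
  mfderiv (𝓡 n) (𝓡 n) (chartAt (EuclideanSpace ℝ (Fin n)) c).symm y
    (EuclideanSpace.single j (1 : ℝ))

/-- A real function of `n`-tuples of tangent vectors is smooth if its values on the coordinate
frames are smooth functions of the coordinates. -/
def IsSmoothOnFrames (μ : ∀ x : M, (Fin n → TangentSpace (𝓡 n) x) → ℝ) : Prop :=
  ∀ c : M, ContDiffOn ℝ ∞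
    (fun y => μ ((chartAt (EuclideanSpace ℝ (Fin n)) c).symm y) (chartFrame c y))
    (chartAt (EuclideanSpace ℝ (Fin n)) c).target

/-- Smooth (signed) densities: `μ x (A v₁, …, A vₙ) = |det A| μ x (v₁, …, vₙ)`. -/
structure IsSmoothDensity (μ : ∀ x : M, (Fin n → TangentSpace (𝓡 n) x) → ℝ) : Prop where
  map_linear : ∀ (x : M) (A : TangentSpace (𝓡 n) x →ₗ[ℝ] TangentSpace (𝓡 n) x)
    (v : Fin n → TangentSpace (𝓡 n) x), μ x (fun j => A (v j)) = |LinearMap.det A| * μ x v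
  smooth : IsSmoothOnFrames μ

/-- The functional `u` is integration against a smooth density. By partitions of unity it suffices
to express `u f = ∫ f dμ` for the functions `f` supported in a single chart domain. -/
def IsSmoothFunctional (u : C^∞⟮𝓡 n, M; ℝ⟯ →ₗ[ℝ] ℝ) : Prop :=
  ∃ μ : ∀ x : M, (Fin n → TangentSpace (𝓡 n) x) → ℝ, IsSmoothDensity μ ∧
    ∀ (c : M) (f : C^∞⟮𝓡 n, M; ℝ⟯),
      tsupport f ⊆ (chartAt (EuclideanSpace ℝ (Fin n)) c).source →
      u f = ∫ y in (chartAt (EuclideanSpace ℝ (Fin n)) c).target,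
        f ((chartAt (EuclideanSpace ℝ (Fin n)) c).symm y) *
          μ ((chartAt (EuclideanSpace ℝ (Fin n)) c).symm y) (chartFrame c y)

variable (n M) in
/-- `M` is orientable: it is covered by smooth charts whose coordinate changes have positive
Jacobian determinant. -/
def IsOrientable : Prop :=
  ∃ A ⊆ IsManifold.maximalAtlas (𝓡 n) ∞ M,
    (∀ x : M, ∃ φ ∈ A, x ∈ φ.source) ∧
    ∀ φ ∈ A, ∀ ψ ∈ A, ∀ y ∈ φ.target, φ.symm y ∈ ψ.source →
      0 < (fderiv ℝ (fun z => ψ (φ.symm z)) y).det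

end Manifold

section Action

variable (k : ℕ) {n : ℕ} {M : Type*} [TopologicalSpace M]
  [ChartedSpace (EuclideanSpace ℝ (Fin n)) M]
  [AddAction (EuclideanSpace ℝ (Fin k)) M]

variable (n) in
/-- The `i`-th generator `X_i` of an `ℝ^k`-action: the velocity at `t = 0` of
`t ↦ (t e_i) · x`. -/
def generator (i : Fin k) (x : M) : TangentSpace (𝓡 n) x :=
  mfderiv 𝓘(ℝ, ℝ) (𝓡 n) (fun t : ℝ => (t • EuclideanSpace.single i (1 : ℝ) :
    EuclideanSpace ℝ (Fin k)) +ᵥ x) 0 (1 : ℝ)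

/-- A real function of `n`-tuples of tangent vectors is invariant under the action: it is equal to
its pull-back by each of the diffeomorphisms `x ↦ a · x`. -/
def IsActionInvariant (μ : ∀ x : M, (Fin n → TangentSpace (𝓡 n) x) → ℝ) : Prop :=
  ∀ (a : EuclideanSpace ℝ (Fin k)) (x : M) (v : Fin n → TangentSpace (𝓡 n) x),
    μ (a +ᵥ x) (fun j => mfderiv (𝓡 n) (𝓡 n) (fun z : M => a +ᵥ z) x (v j)) = μ x v

variable [ContMDiffVAdd (𝓡 k) (𝓡 n) ∞ (EuclideanSpace ℝ (Fin k)) M]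

theorem contMDiff_orbit (i : Fin k) :
    ContMDiff ((𝓡 n).prod 𝓘(ℝ, ℝ)) (𝓡 n) ∞ (fun p : M × ℝ =>
      (p.2 • EuclideanSpace.single i (1 : ℝ) : EuclideanSpace ℝ (Fin k)) +ᵥ p.1) := by
  have h := ContMDiffVAdd.contMDiff_vadd (I := 𝓡 k) (I' := 𝓡 n) (n := ∞)
    (G := EuclideanSpace ℝ (Fin k)) (M := M)
  refine h.comp (ContMDiff.prodMk ?_ contMDiff_fst)
  have : ContMDiff 𝓘(ℝ, ℝ) (𝓡 k) ∞
      (fun t : ℝ => (t • EuclideanSpace.single i (1 : ℝ) : EuclideanSpace ℝ (Fin k))) :=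
    ContDiff.contMDiff (by fun_prop)
  exact this.comp contMDiff_snd

theorem mfderiv_generator (i : Fin k) (f : C^∞⟮𝓡 n, M; ℝ⟯) (x : M) :
    (show ℝ from mfderiv (𝓡 n) 𝓘(ℝ, ℝ) f x (generator k n i x)) =
      deriv (fun t : ℝ => f ((t • EuclideanSpace.single i (1 : ℝ) :
        EuclideanSpace ℝ (Fin k)) +ᵥ x)) 0 := by
  have h0 : ((0 : ℝ) • EuclideanSpace.single i (1 : ℝ) : EuclideanSpace ℝ (Fin k)) +ᵥ x = x := by
    rw [zero_smul, zero_vadd]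
  have hg : MDifferentiableAt 𝓘(ℝ, ℝ) (𝓡 n) (fun t : ℝ =>
      (t • EuclideanSpace.single i (1 : ℝ) : EuclideanSpace ℝ (Fin k)) +ᵥ x) 0 :=
    (((contMDiff_orbit (n := n) (M := M) k i).comp
      (contMDiff_const.prodMk contMDiff_id)).mdifferentiable (by simp)) 0
  have hf : MDifferentiable (𝓡 n) 𝓘(ℝ, ℝ) f := f.contMDiff.mdifferentiable (by simp)
  have := mfderiv_comp_of_eq (x := (0 : ℝ)) (hf x) hg h0
  have h2 : mfderiv 𝓘(ℝ, ℝ) 𝓘(ℝ, ℝ) (fun t : ℝ => f ((t • EuclideanSpace.single i (1 : ℝ) :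
        EuclideanSpace ℝ (Fin k)) +ᵥ x)) 0 (1 : ℝ) = _ :=
    congrArg (fun L => L (1 : ℝ)) this
  rw [mfderiv_eq_fderiv] at h2
  refine Eq.trans ?_ h2.symm
  rw [h0]
  rfl

variable [IsManifold (𝓡 n) ∞ M]

/-- The Lie derivative of smooth functions along the generator `X_i`. -/
def lieDeriv (i : Fin k) : C^∞⟮𝓡 n, M; ℝ⟯ →ₗ[ℝ] C^∞⟮𝓡 n, M; ℝ⟯ where
  toFun f :=
    ⟨fun x => mfderiv (𝓡 n) 𝓘(ℝ, ℝ) f x (generator k n i x), by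
      refine ContMDiff.congr ?_ (mfderiv_generator k i f)
      intro x
      have : IsManifold (𝓡 n) 1 M := IsManifold.of_le (n := ∞) (by simp)
      have hF : ContMDiff ((𝓡 n).prod 𝓘(ℝ, ℝ)) 𝓘(ℝ, ℝ) ∞ (Function.uncurry
          (fun (x : M) (t : ℝ) => f ((t • EuclideanSpace.single i (1 : ℝ) :
            EuclideanSpace ℝ (Fin k)) +ᵥ x))) :=
        f.contMDiff.comp (contMDiff_orbit (n := n) (M := M) k i)
      have hd := ContMDiffAt.mfderiv_apply (I := 𝓘(ℝ, ℝ)) (I' := 𝓘(ℝ, ℝ)) (J := 𝓡 n) (x₀ := x)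
        (m := ∞) (n := ∞) (J' := 𝓡 n) (fun (x : M) (t : ℝ) =>
          f ((t • EuclideanSpace.single i (1 : ℝ) : EuclideanSpace ℝ (Fin k)) +ᵥ x))
        (fun _ => (0 : ℝ)) id (fun _ => (1 : ℝ)) (hF _) contMDiffAt_const contMDiffAt_id
        contMDiffAt_const (by simp)
      simpa [inTangentCoordinates_model_space] using hd⟩
  map_add' f g := by
    ext x
    have hf : MDifferentiableAt (𝓡 n) 𝓘(ℝ, ℝ) f x := f.contMDiff.mdifferentiable (by simp) x
    have hg : MDifferentiableAt (𝓡 n) 𝓘(ℝ, ℝ) g x := g.contMDiff.mdifferentiable (by simp) x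
    exact congrArg (fun L => L (generator k n i x)) (mfderiv_add hf hg)
  map_smul' a f := by
    ext x
    have hf : MDifferentiableAt (𝓡 n) 𝓘(ℝ, ℝ) f x := f.contMDiff.mdifferentiable (by simp) x
    exact congrArg (fun L => L (generator k n i x)) (const_smul_mfderiv hf a)

variable (n M) in
/-- The leafwise Laplacian `X_1² + ⋯ + X_k²`. -/
def leafwiseLaplacian : C^∞⟮𝓡 n, M; ℝ⟯ →ₗ[ℝ] C^∞⟮𝓡 n, M; ℝ⟯ :=
  ∑ i : Fin k, lieDeriv k i ∘ₗ lieDeriv k i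

variable (n M) in
/-- Global hypoellipticity of the leafwise Laplacian `L`: every distribution `u` with `L u` smooth
is smooth. On distributions the Lie derivative is `(X_i u) f = -u (X_i f)`, so that
`(L u) f = u (L f)`. -/
def IsGloballyHypoelliptic : Prop :=
  ∀ u : Distribution n M,
    IsSmoothFunctional ((u : C^∞⟮𝓡 n, M; ℝ⟯ →ₗ[ℝ] ℝ) ∘ₗ leafwiseLaplacian k n M) →
      IsSmoothFunctional (u : C^∞⟮𝓡 n, M; ℝ⟯ →ₗ[ℝ] ℝ)

variable (n M) in
/-- The kernel of `X_i` on distributions: the `D` with `D (X_i f) = 0` for all smooth `f`. -/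
def kerLieDeriv (i : Fin k) : Submodule ℝ (Distribution n M) where
  carrier := {D | ∀ f : C^∞⟮𝓡 n, M; ℝ⟯, D (lieDeriv k i f) = 0}
  zero_mem' := fun _ => rfl
  add_mem' := fun {D E} hD hE f => by
    change D (lieDeriv k i f) + E (lieDeriv k i f) = 0
    rw [hD f, hE f, add_zero]
  smul_mem' := fun a D hD f => by
    change a • D (lieDeriv k i f) = 0
    rw [hD f, smul_zero]

end Action

end LeafwiseGH

end

/-! Hypoellipticity makes every invariant distribution smooth: if all `X_i D` vanish, then `L_ρ D =
0`. Invariant distributions exist because `ℝ^k` is amenable. Averaging `f` over the orbit of `x`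
against a bump kernel dilated by `N + 1`, and passing to an ultrafilter limit, gives a positive
functional `orbitMean` of value `1` on the constant `1`, invariant under translations and under the
`X_i`, and continuous because it is bounded by the sup norm. It is therefore integration against a
smooth density `μ`.

This density forces the action to be minimal. If `Z` is closed, invariant and contains `x`, the mean
at `x` is supported in `Z`. If `Z` had empty interior, `μ` would vanish on a dense set, hence
everywhere, against total mass `1` (`nonempty_interior`). The frontier of a closed invariant set is
closed and invariant with empty interior, so it is empty, and connectedness gives `eq_univ`. Applied
to the zero set of `μ`, minimality yields `μ > 0` (`frameValue_pos`), which is the invariant volume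
density.

For uniqueness (`exists_eq_smul`), an invariant `D` is `h μ` with `h` smooth. Integrating by parts,
the integral of `(X_i h)²` against `μ` is zero, so `X_i h = 0`. Thus `h` is constant on orbits, and
constant by minimality.

On an orientable manifold `μ` is turned into a form by attaching the sign of the orientation.
Translations preserve this sign because `ℝ^k` is connected (`frameSign_vadd_mul_sign_mapJac`). -/

noncomputable section

namespace LeafwiseGH

open Set Filter Topology IsManifold

/-! ### Jacobian determinants in charts -/

section Jacobian

variable {n : ℕ} {M : Type*} [TopologicalSpace M] [ChartedSpace (EuclideanSpace ℝ (Fin n)) M]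

/-- The Jacobian determinant of `φ⁻¹` at `y`, computed in the preferred trivializations of the
tangent spaces. -/
def symmJac (φ : OpenPartialHomeomorph M (EuclideanSpace ℝ (Fin n)))
    (y : EuclideanSpace ℝ (Fin n)) : ℝ :=
  (show EuclideanSpace ℝ (Fin n) →L[ℝ] EuclideanSpace ℝ (Fin n) from
    mfderiv (𝓡 n) (𝓡 n) φ.symm y).det

variable (n) in
/-- The Jacobian determinant of a self-map of `M`, computed in the preferred trivializations of the
tangent spaces. -/
def mapJac (g : M → M) (x : M) : ℝ :=
  (show EuclideanSpace ℝ (Fin n) →L[ℝ] EuclideanSpace ℝ (Fin n) from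
    mfderiv (𝓡 n) (𝓡 n) g x).det

theorem mapJac_id (x : M) : mapJac n (fun z : M => z) x = 1 := by
  unfold mapJac
  have : mfderiv (𝓡 n) (𝓡 n) (fun z : M => z) x = ContinuousLinearMap.id ℝ _ := mfderiv_id
  rw [this]
  exact LinearMap.det_id

theorem det_comp_continuous (A B : EuclideanSpace ℝ (Fin n) →L[ℝ] EuclideanSpace ℝ (Fin n)) :
    (A.comp B).det = A.det * B.det :=
  LinearMap.det_comp _ _

/-- Chain rule for the two factorizations of `g ∘ φ⁻¹`, the second being `ψ⁻¹ ∘ (ψ ∘ g ∘ φ⁻¹)` near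
`y`. The pointwise factors refer to a preferred chart varying with the point and need not be
continuous; the last determinant is. -/
theorem mapJac_mul_symmJac {φ ψ : OpenPartialHomeomorph M (EuclideanSpace ℝ (Fin n))}
    (hφ : φ ∈ maximalAtlas (𝓡 n) ∞ M) (hψ : ψ ∈ maximalAtlas (𝓡 n) ∞ M) {g : M → M}
    (hg : ContMDiff (𝓡 n) (𝓡 n) ∞ g) {y : EuclideanSpace ℝ (Fin n)} (hy : y ∈ φ.target)
    (hgy : g (φ.symm y) ∈ ψ.source) :
    mapJac n g (φ.symm y) * symmJac φ y =
      symmJac ψ (ψ (g (φ.symm y))) * (fderiv ℝ (fun z => ψ (g (φ.symm z))) y).det := by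
  have hφs : ContMDiffAt (𝓡 n) (𝓡 n) ∞ φ.symm y := contMDiffAt_symm_of_mem_maximalAtlas hφ hy
  have hgs : ContMDiffAt (𝓡 n) (𝓡 n) ∞ (fun z => g (φ.symm z)) y := hg.contMDiffAt.comp y hφs
  have hc : ContMDiffAt (𝓡 n) (𝓡 n) ∞ (fun z => ψ (g (φ.symm z))) y :=
    (contMDiffAt_of_mem_maximalAtlas hψ hgy).comp y hgs
  have hψs : ContMDiffAt (𝓡 n) (𝓡 n) ∞ ψ.symm (ψ (g (φ.symm y))) :=
    contMDiffAt_symm_of_mem_maximalAtlas hψ (ψ.map_source hgy)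
  have hev : (fun z => g (φ.symm z)) =ᶠ[𝓝 y] fun z => ψ.symm (ψ (g (φ.symm z))) := by
    filter_upwards [hgs.continuousAt.preimage_mem_nhds (ψ.open_source.mem_nhds hgy)] with z hz
    exact (ψ.left_inv hz).symm
  have h1 := mfderiv_comp y (hg.mdifferentiable (by simp) (φ.symm y))
    (hφs.mdifferentiableAt (by simp))
  have h2 := mfderiv_comp y (hψs.mdifferentiableAt (by simp)) (hc.mdifferentiableAt (by simp))
  have h3 : mfderiv (𝓡 n) (𝓡 n) (fun z => g (φ.symm z)) y =
      mfderiv (𝓡 n) (𝓡 n) (fun z => ψ.symm (ψ (g (φ.symm z)))) y := hev.mfderiv_eq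
  unfold mapJac symmJac
  rw [← det_comp_continuous, ← det_comp_continuous]
  have h4 := h1.symm.trans (h3.trans h2)
  rw [mfderiv_eq_fderiv] at h4
  exact congrArg (ContinuousLinearMap.det (M := EuclideanSpace ℝ (Fin n))) h4

theorem symmJac_eq {φ ψ : OpenPartialHomeomorph M (EuclideanSpace ℝ (Fin n))}
    (hφ : φ ∈ maximalAtlas (𝓡 n) ∞ M) (hψ : ψ ∈ maximalAtlas (𝓡 n) ∞ M)
    {y : EuclideanSpace ℝ (Fin n)} (hy : y ∈ φ.target) (hgy : φ.symm y ∈ ψ.source) :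
    symmJac φ y = symmJac ψ (ψ (φ.symm y)) * (fderiv ℝ (fun z => ψ (φ.symm z)) y).det := by
  refine Eq.trans ?_ (mapJac_mul_symmJac hφ hψ contMDiff_id hy hgy)
  change symmJac φ y = mapJac n (fun z : M => z) _ * _
  rw [mapJac_id, one_mul]

theorem symmJac_ne_zero {φ : OpenPartialHomeomorph M (EuclideanSpace ℝ (Fin n))}
    (hφ : φ ∈ maximalAtlas (𝓡 n) ∞ M) {y : EuclideanSpace ℝ (Fin n)} (hy : y ∈ φ.target) :
    symmJac φ y ≠ 0 := by
  have hφs : ContMDiffAt (𝓡 n) (𝓡 n) ∞ φ.symm y := contMDiffAt_symm_of_mem_maximalAtlas hφ hy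
  have hφd : ContMDiffAt (𝓡 n) (𝓡 n) ∞ φ (φ.symm y) :=
    contMDiffAt_of_mem_maximalAtlas hφ (φ.map_target hy)
  have h1 := mfderiv_comp y (hφd.mdifferentiableAt (by simp)) (hφs.mdifferentiableAt (by simp))
  have hev : (φ ∘ φ.symm) =ᶠ[𝓝 y] id := by
    filter_upwards [φ.open_target.mem_nhds hy] with z hz
    exact φ.right_inv hz
  have h2 : mfderiv (𝓡 n) (𝓡 n) (φ ∘ φ.symm) y =
      mfderiv (𝓡 n) (𝓡 n) (id : EuclideanSpace ℝ (Fin n) → _) y := hev.mfderiv_eq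
  have h3 := h1.symm.trans h2
  rw [mfderiv_id] at h3
  have h4 := congrArg (ContinuousLinearMap.det (M := EuclideanSpace ℝ (Fin n))) h3
  have h5 : ContinuousLinearMap.det (ContinuousLinearMap.id ℝ (EuclideanSpace ℝ (Fin n))) = 1 :=
    LinearMap.det_id
  intro h0
  have h6 := (det_comp_continuous _ _).symm.trans (h4.trans h5)
  unfold symmJac at h0
  rw [h0, mul_zero] at h6
  exact zero_ne_one h6

theorem contDiffAt_coord {φ ψ : OpenPartialHomeomorph M (EuclideanSpace ℝ (Fin n))}
    (hφ : φ ∈ maximalAtlas (𝓡 n) ∞ M) (hψ : ψ ∈ maximalAtlas (𝓡 n) ∞ M) {g : M → M}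
    (hg : ContMDiff (𝓡 n) (𝓡 n) ∞ g) {y : EuclideanSpace ℝ (Fin n)} (hy : y ∈ φ.target)
    (hgy : g (φ.symm y) ∈ ψ.source) : ContDiffAt ℝ ∞ (fun z => ψ (g (φ.symm z))) y :=
  ((contMDiffAt_of_mem_maximalAtlas hψ hgy).comp y
    (hg.contMDiffAt.comp y (contMDiffAt_symm_of_mem_maximalAtlas hφ hy))).contDiffAt

theorem continuousAt_det_fderiv {F : EuclideanSpace ℝ (Fin n) → EuclideanSpace ℝ (Fin n)}
    {y : EuclideanSpace ℝ (Fin n)} (hF : ContDiffAt ℝ ∞ F y) :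
    ContinuousAt (fun z => (fderiv ℝ F z).det) y :=
  ContinuousLinearMap.continuous_det.continuousAt.comp
    (hF.continuousAt_fderiv (by simp))

theorem det_fderiv_coord_ne_zero {φ ψ : OpenPartialHomeomorph M (EuclideanSpace ℝ (Fin n))}
    (hφ : φ ∈ maximalAtlas (𝓡 n) ∞ M) (hψ : ψ ∈ maximalAtlas (𝓡 n) ∞ M)
    {y : EuclideanSpace ℝ (Fin n)} (hy : y ∈ φ.target) (hgy : φ.symm y ∈ ψ.source) :
    (fderiv ℝ (fun z => ψ (φ.symm z)) y).det ≠ 0 := by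
  intro h
  have := symmJac_eq hφ hψ hy hgy
  rw [h, mul_zero] at this
  exact symmJac_ne_zero hφ hy this

end Jacobian

/-! ### Densities and their coordinate expressions -/

section Density

variable {n : ℕ} {M : Type*} [TopologicalSpace M] [ChartedSpace (EuclideanSpace ℝ (Fin n)) M]

/-- The value of `μ` at `x` on the standard basis of the model space, seen as a basis of the
tangent space. -/
def frameValue (μ : ∀ x : M, (Fin n → TangentSpace (𝓡 n) x) → ℝ) (x : M) : ℝ :=
  μ x (fun j => (EuclideanSpace.single j (1 : ℝ) : EuclideanSpace ℝ (Fin n)))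

/-- The linear endomorphism of the model space with prescribed values on the standard basis. -/
def frameMap (v : Fin n → EuclideanSpace ℝ (Fin n)) :
    EuclideanSpace ℝ (Fin n) →ₗ[ℝ] EuclideanSpace ℝ (Fin n) :=
  (EuclideanSpace.basisFun (Fin n) ℝ).toBasis.constr ℝ v

theorem frameMap_single (v : Fin n → EuclideanSpace ℝ (Fin n)) (j : Fin n) :
    frameMap v (EuclideanSpace.single j (1 : ℝ)) = v j := by
  simp [frameMap]

theorem basisFun_det_eq (v : Fin n → EuclideanSpace ℝ (Fin n)) :
    (EuclideanSpace.basisFun (Fin n) ℝ).toBasis.det v = LinearMap.det (frameMap v) := by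
  set b := (EuclideanSpace.basisFun (Fin n) ℝ).toBasis
  have h := b.det_comp (frameMap v) b
  rw [b.det_self, mul_one] at h
  rw [← h]
  congr 1
  ext1 j
  exact (b.constr_basis ℝ v j).symm

theorem frameMap_comp
    (T : EuclideanSpace ℝ (Fin n) →ₗ[ℝ] EuclideanSpace ℝ (Fin n))
    (v : Fin n → EuclideanSpace ℝ (Fin n)) :
    frameMap (fun j => T (v j)) = T ∘ₗ frameMap v := by
  refine (EuclideanSpace.basisFun (Fin n) ℝ).toBasis.ext fun j => ?_
  have h : (EuclideanSpace.basisFun (Fin n) ℝ).toBasis j = EuclideanSpace.single j (1 : ℝ) := by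
    simp
  rw [h, LinearMap.comp_apply, frameMap_single, frameMap_single]

theorem det_frameMap_ne_zero {v : Fin n → EuclideanSpace ℝ (Fin n)} (hv : LinearIndependent ℝ v) :
    LinearMap.det (frameMap v) ≠ 0 := by
  rw [← basisFun_det_eq]
  have hspan : Submodule.span ℝ (range v) = ⊤ :=
    hv.span_eq_top_of_card_eq_finrank' (by simp)
  exact ((EuclideanSpace.basisFun (Fin n) ℝ).toBasis.is_basis_iff_det.1 ⟨hv, hspan⟩).ne_zero

variable {μ ν : ∀ x : M, (Fin n → TangentSpace (𝓡 n) x) → ℝ}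

theorem IsSmoothDensity.apply_comp (hμ : IsSmoothDensity μ) (x : M)
    (T : EuclideanSpace ℝ (Fin n) →ₗ[ℝ] EuclideanSpace ℝ (Fin n)) :
    μ x (fun j => T (EuclideanSpace.single j (1 : ℝ))) = |LinearMap.det T| * frameValue μ x :=
  hμ.map_linear x T _

theorem IsSmoothDensity.apply_eq (hμ : IsSmoothDensity μ) (x : M)
    (v : Fin n → EuclideanSpace ℝ (Fin n)) :
    μ x v = |LinearMap.det (frameMap v)| * frameValue μ x := by
  rw [← hμ.apply_comp]
  congr 1
  ext1 j
  exact (frameMap_single v j).symm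

theorem IsSmoothDensity.apply_chartFrame (hμ : IsSmoothDensity μ) (c : M)
    (y : EuclideanSpace ℝ (Fin n)) :
    μ ((chartAt (EuclideanSpace ℝ (Fin n)) c).symm y) (chartFrame c y) =
      |symmJac (chartAt (EuclideanSpace ℝ (Fin n)) c) y| *
        frameValue μ ((chartAt (EuclideanSpace ℝ (Fin n)) c).symm y) :=
  hμ.apply_comp _ _

/-- The coordinate expression of a density in the preferred chart at `c`. -/
def chartDensity (μ : ∀ x : M, (Fin n → TangentSpace (𝓡 n) x) → ℝ) (c : M)
    (y : EuclideanSpace ℝ (Fin n)) : ℝ :=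
  μ ((chartAt (EuclideanSpace ℝ (Fin n)) c).symm y) (chartFrame c y)

theorem IsSmoothDensity.chartDensity_eq (hμ : IsSmoothDensity μ) (c : M)
    (y : EuclideanSpace ℝ (Fin n)) :
    chartDensity μ c y = |symmJac (chartAt (EuclideanSpace ℝ (Fin n)) c) y| *
        frameValue μ ((chartAt (EuclideanSpace ℝ (Fin n)) c).symm y) :=
  hμ.apply_chartFrame c y

theorem IsSmoothDensity.contDiffOn_chartDensity (hμ : IsSmoothDensity μ) (c : M) :
    ContDiffOn ℝ ∞ (chartDensity μ c) (chartAt (EuclideanSpace ℝ (Fin n)) c).target :=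
  hμ.smooth c

variable [IsManifold (𝓡 n) ∞ M]

theorem IsSmoothDensity.chartDensity_eq_zero_iff (hμ : IsSmoothDensity μ) {c : M}
    {y : EuclideanSpace ℝ (Fin n)} (hy : y ∈ (chartAt (EuclideanSpace ℝ (Fin n)) c).target) :
    chartDensity μ c y = 0 ↔
      frameValue μ ((chartAt (EuclideanSpace ℝ (Fin n)) c).symm y) = 0 := by
  rw [hμ.chartDensity_eq, mul_eq_zero, abs_eq_zero]
  exact or_iff_right (symmJac_ne_zero (chart_mem_maximalAtlas c) hy)

/-- The Jacobian factor cancels in the quotient, so ratios of frame values are smooth even though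
frame values themselves need not be. -/
theorem IsSmoothDensity.chartDensity_div (hμ : IsSmoothDensity μ) (hν : IsSmoothDensity ν) {c : M}
    {y : EuclideanSpace ℝ (Fin n)} (hy : y ∈ (chartAt (EuclideanSpace ℝ (Fin n)) c).target) :
    chartDensity ν c y / chartDensity μ c y =
      frameValue ν ((chartAt (EuclideanSpace ℝ (Fin n)) c).symm y) /
        frameValue μ ((chartAt (EuclideanSpace ℝ (Fin n)) c).symm y) := by
  rw [hμ.chartDensity_eq, hν.chartDensity_eq]
  exact mul_div_mul_left _ _ (abs_ne_zero.2 (symmJac_ne_zero (chart_mem_maximalAtlas c) hy))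

/-- Since `frameValue μ` may be discontinuous, the argument passes to the coordinate expression in
one fixed chart, which is continuous and has the same zeros there. -/
theorem isClosed_frameValue_eq_zero (hμ : IsSmoothDensity μ) :
    IsClosed {x : M | frameValue μ x = 0} := by
  rw [← isOpen_compl_iff, isOpen_iff_mem_nhds]
  intro x hx
  set φ := chartAt (EuclideanSpace ℝ (Fin n)) x with hφ
  have hxs : x ∈ φ.source := mem_chart_source _ x
  have hc : ContinuousAt (fun z => chartDensity μ x (φ z)) x :=
    ((hμ.contDiffOn_chartDensity x).continuousOn.continuousAt
      (φ.open_target.mem_nhds (φ.map_source hxs))).comp (φ.continuousAt hxs)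
  have hx0 : chartDensity μ x (φ x) ≠ 0 := by
    rw [Ne, hμ.chartDensity_eq_zero_iff (φ.map_source hxs), φ.left_inv hxs]
    exact hx
  filter_upwards [hc.eventually_ne hx0, φ.open_source.mem_nhds hxs] with z hz hzs
  rw [Ne, hμ.chartDensity_eq_zero_iff (φ.map_source hzs), φ.left_inv hzs] at hz
  exact hz

end Density

/-! ### Test functions supported in a chart -/

section TestFunctions

variable {n : ℕ} {M : Type*} [TopologicalSpace M] [ChartedSpace (EuclideanSpace ℝ (Fin n)) M]

/-- The integrand of the integral of `f` against the density with coordinate expression `G`,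
extended by zero outside the chart domain. -/
def chartIntegrand (c : M) (f : M → ℝ) (G : EuclideanSpace ℝ (Fin n) → ℝ) :
    EuclideanSpace ℝ (Fin n) → ℝ :=
  (chartAt (EuclideanSpace ℝ (Fin n)) c).target.indicator
    (fun y => f ((chartAt (EuclideanSpace ℝ (Fin n)) c).symm y) * G y)

theorem integral_chartIntegrand (c : M) (f : M → ℝ) (G : EuclideanSpace ℝ (Fin n) → ℝ) :
    ∫ y, chartIntegrand c f G y = ∫ y in (chartAt (EuclideanSpace ℝ (Fin n)) c).target,
      f ((chartAt (EuclideanSpace ℝ (Fin n)) c).symm y) * G y :=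
  integral_indicator (chartAt (EuclideanSpace ℝ (Fin n)) c).open_target.measurableSet

theorem chartIntegrand_eq_zero {c : M} {f : M → ℝ} {G : EuclideanSpace ℝ (Fin n) → ℝ}
    {y : EuclideanSpace ℝ (Fin n)}
    (hy : y ∉ (chartAt (EuclideanSpace ℝ (Fin n)) c) '' tsupport f) :
    chartIntegrand c f G y = 0 := by
  set φ := chartAt (EuclideanSpace ℝ (Fin n)) c
  by_cases hyt : y ∈ φ.target
  · have : f (φ.symm y) = 0 := by
      by_contra h
      exact hy ⟨φ.symm y, subset_tsupport f h, φ.right_inv hyt⟩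
    rw [chartIntegrand, indicator_of_mem hyt, this, zero_mul]
  · exact indicator_of_notMem hyt _

section Bump

variable [IsManifold (𝓡 n) ∞ M] [T2Space M]

theorem exists_smooth_bump {W : Set M} {x : M} (hW : W ∈ 𝓝 x) :
    ∃ f : C^∞⟮𝓡 n, M; ℝ⟯, (∀ z, 0 ≤ f z) ∧ (∀ z, f z ≤ 1) ∧ f x = 1 ∧ tsupport f ⊆ W := by
  obtain ⟨b, -, hb⟩ := (SmoothBumpFunction.nhds_basis_tsupport (I := 𝓡 n) x).mem_iff.1 hW
  exact ⟨⟨b, b.contMDiff⟩, fun _ => b.nonneg, fun _ => b.le_one, b.eq_one, hb⟩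

end Bump

variable [CompactSpace M]

theorem isCompact_image_tsupport {c : M} {f : M → ℝ}
    (hf : tsupport f ⊆ (chartAt (EuclideanSpace ℝ (Fin n)) c).source) :
    IsCompact ((chartAt (EuclideanSpace ℝ (Fin n)) c) '' tsupport f) :=
  (isClosed_tsupport f).isCompact.image_of_continuousOn
    ((chartAt (EuclideanSpace ℝ (Fin n)) c).continuousOn.mono hf)

theorem hasCompactSupport_chartIntegrand {c : M} {f : M → ℝ}
    (hf : tsupport f ⊆ (chartAt (EuclideanSpace ℝ (Fin n)) c).source)
    (G : EuclideanSpace ℝ (Fin n) → ℝ) : HasCompactSupport (chartIntegrand c f G) :=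
  HasCompactSupport.intro (isCompact_image_tsupport hf) fun _ hy => chartIntegrand_eq_zero hy

theorem continuous_chartIntegrand {c : M} {f : M → ℝ} (hfc : Continuous f)
    (hf : tsupport f ⊆ (chartAt (EuclideanSpace ℝ (Fin n)) c).source)
    {V : Set (EuclideanSpace ℝ (Fin n))} (hV : IsOpen V)
    (hfV : tsupport f ⊆ (chartAt (EuclideanSpace ℝ (Fin n)) c) ⁻¹' V)
    {G : EuclideanSpace ℝ (Fin n) → ℝ} (hG : ContinuousOn G V) :
    Continuous (chartIntegrand c f G) := by
  set φ := chartAt (EuclideanSpace ℝ (Fin n)) c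
  rw [continuous_iff_continuousAt]
  intro y
  by_cases hy : y ∈ φ '' tsupport f
  · obtain ⟨x, hx, rfl⟩ := hy
    have hyt := φ.map_source (hf hx)
    have h1 : ContinuousAt (fun y => f (φ.symm y) * G y) (φ x) :=
      (hfc.continuousAt.comp (φ.symm.continuousAt hyt)).mul
        (hG.continuousAt (hV.mem_nhds (hfV hx)))
    refine h1.congr ?_
    filter_upwards [φ.open_target.mem_nhds hyt] with z hz
    rw [chartIntegrand, indicator_of_mem hz]
  · have h0 : ContinuousAt (fun _ : EuclideanSpace ℝ (Fin n) => (0 : ℝ)) y := continuousAt_const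
    refine h0.congr ?_
    filter_upwards [(isCompact_image_tsupport hf).isClosed.isOpen_compl.mem_nhds hy] with z hz
    exact (chartIntegrand_eq_zero hz).symm

theorem integral_chartIntegrand_pos {c : M} {f : M → ℝ} (hfc : Continuous f)
    (hf : tsupport f ⊆ (chartAt (EuclideanSpace ℝ (Fin n)) c).source)
    {V : Set (EuclideanSpace ℝ (Fin n))} (hV : IsOpen V)
    (hfV : tsupport f ⊆ (chartAt (EuclideanSpace ℝ (Fin n)) c) ⁻¹' V)
    {G : EuclideanSpace ℝ (Fin n) → ℝ} (hG : ContinuousOn G V) (hGV : ∀ y ∈ V, 0 < G y)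
    (hf0 : ∀ x, 0 ≤ f x) {x : M} (hx : f x ≠ 0) :
    0 < ∫ y, chartIntegrand c f G y := by
  set φ := chartAt (EuclideanSpace ℝ (Fin n)) c
  have hxs : x ∈ tsupport f := subset_tsupport f hx
  refine (continuous_chartIntegrand hfc hf hV hfV hG).integral_pos_of_hasCompactSupport_nonneg_nonzero
    (hasCompactSupport_chartIntegrand hf G) (fun y => ?_) (x := φ x) ?_
  · by_cases hy : y ∈ φ '' tsupport f
    · obtain ⟨x, hx, rfl⟩ := hy
      rw [chartIntegrand, indicator_of_mem (φ.map_source (hf hx))]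
      exact mul_nonneg (hf0 _) (hGV _ (hfV hx)).le
    · exact (chartIntegrand_eq_zero hy).ge
  · rw [chartIntegrand, indicator_of_mem (φ.map_source (hf hxs)), φ.left_inv (hf hxs)]
    exact mul_ne_zero hx (hGV _ (hfV hxs)).ne'

variable [IsManifold (𝓡 n) ∞ M] [T2Space M]

/-- A bump supported where `G < 0` would have a negative integral against `G`. -/
theorem nonneg_of_integral_chartIntegrand_nonneg {c : M}
    {V : Set (EuclideanSpace ℝ (Fin n))} (hV : IsOpen V)
    (hVt : V ⊆ (chartAt (EuclideanSpace ℝ (Fin n)) c).target)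
    {G : EuclideanSpace ℝ (Fin n) → ℝ} (hG : ContinuousOn G V)
    (h : ∀ f : C^∞⟮𝓡 n, M; ℝ⟯, (∀ z, 0 ≤ f z) →
      tsupport f ⊆ (chartAt (EuclideanSpace ℝ (Fin n)) c).source →
      tsupport f ⊆ (chartAt (EuclideanSpace ℝ (Fin n)) c) ⁻¹' V →
      0 ≤ ∫ y, chartIntegrand c f G y) {y : EuclideanSpace ℝ (Fin n)} (hy : y ∈ V) : 0 ≤ G y := by
  set φ := chartAt (EuclideanSpace ℝ (Fin n)) c
  by_contra! hneg
  have hV' : IsOpen (V ∩ G ⁻¹' Iio 0) := hG.isOpen_inter_preimage hV isOpen_Iio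
  have hs : φ.symm y ∈ φ.source := φ.map_target (hVt hy)
  have hW : φ.source ∩ φ ⁻¹' (V ∩ G ⁻¹' Iio 0) ∈ 𝓝 (φ.symm y) := by
    refine (φ.isOpen_inter_preimage hV').mem_nhds ⟨hs, ?_⟩
    rw [mem_preimage, φ.right_inv (hVt hy)]
    exact ⟨hy, hneg⟩
  obtain ⟨f, hf0, -, hf1, hfs⟩ := exists_smooth_bump (n := n) hW
  have hfs1 : tsupport f ⊆ φ.source := fun z hz => (hfs hz).1
  have hfs2 : tsupport f ⊆ φ ⁻¹' (V ∩ G ⁻¹' Iio 0) := fun z hz => (hfs hz).2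
  have h1 := h f hf0 hfs1 (fun z hz => (hfs2 hz).1)
  have h2 := integral_chartIntegrand_pos (G := fun y => -G y) f.contMDiff.continuous hfs1 hV' hfs2
    (hG.neg.mono inter_subset_left) (fun y hy => neg_pos.2 hy.2) hf0
    (x := φ.symm y) (by rw [hf1]; exact one_ne_zero)
  have h3 : chartIntegrand c f (fun y => -G y) = fun y => -chartIntegrand c f G y := by
    ext y
    unfold chartIntegrand
    by_cases hy : y ∈ φ.target
    · rw [indicator_of_mem hy, indicator_of_mem hy, mul_neg]
    · rw [indicator_of_notMem hy, indicator_of_notMem hy, neg_zero]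
  rw [h3, integral_neg] at h2
  linarith

theorem eqOn_of_integral_chartIntegrand_eq {c : M}
    {V : Set (EuclideanSpace ℝ (Fin n))} (hV : IsOpen V)
    (hVt : V ⊆ (chartAt (EuclideanSpace ℝ (Fin n)) c).target)
    {G H : EuclideanSpace ℝ (Fin n) → ℝ} (hG : ContinuousOn G V) (hH : ContinuousOn H V)
    (h : ∀ f : C^∞⟮𝓡 n, M; ℝ⟯,
      tsupport f ⊆ (chartAt (EuclideanSpace ℝ (Fin n)) c).source →
      tsupport f ⊆ (chartAt (EuclideanSpace ℝ (Fin n)) c) ⁻¹' V →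
      ∫ y, chartIntegrand c f G y = ∫ y, chartIntegrand c f H y) : EqOn G H V := by
  have key : ∀ {G H : EuclideanSpace ℝ (Fin n) → ℝ}, ContinuousOn G V → ContinuousOn H V →
      (∀ f : C^∞⟮𝓡 n, M; ℝ⟯,
        tsupport f ⊆ (chartAt (EuclideanSpace ℝ (Fin n)) c).source →
        tsupport f ⊆ (chartAt (EuclideanSpace ℝ (Fin n)) c) ⁻¹' V →
        ∫ y, chartIntegrand c f G y = ∫ y, chartIntegrand c f H y) →
      ∀ y ∈ V, 0 ≤ G y - H y := by
    intro G H hG hH h y hy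
    refine nonneg_of_integral_chartIntegrand_nonneg (G := fun y => G y - H y) hV hVt (hG.sub hH)
      (fun f _ hfs hfV => ?_) hy
    have h3 : chartIntegrand c f (fun y => G y - H y) =
        fun y => chartIntegrand c f G y - chartIntegrand c f H y := by
      ext y
      unfold chartIntegrand
      by_cases hy : y ∈ (chartAt (EuclideanSpace ℝ (Fin n)) c).target
      · simp only [indicator_of_mem hy, mul_sub]
      · simp only [indicator_of_notMem hy, sub_zero]
    have hi : ∀ {G : EuclideanSpace ℝ (Fin n) → ℝ}, ContinuousOn G V →
        Integrable (chartIntegrand c f G) := fun hG =>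
      (continuous_chartIntegrand f.contMDiff.continuous hfs hV hfV hG).integrable_of_hasCompactSupport
        (hasCompactSupport_chartIntegrand hfs _)
    rw [h3, integral_sub (hi hG) (hi hH), h f hfs hfV, sub_self]
  intro y hy
  have h1 := key hG hH h y hy
  have h2 := key hH hG (fun f h1 h2 => (h f h1 h2).symm) y hy
  linarith

/-- A linear functional vanishing on the functions supported in a chart domain vanishes. -/
theorem eq_zero_of_forall_chart_supported (u : C^∞⟮𝓡 n, M; ℝ⟯ →ₗ[ℝ] ℝ)
    (hu : ∀ (c : M) (f : C^∞⟮𝓡 n, M; ℝ⟯),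
      tsupport f ⊆ (chartAt (EuclideanSpace ℝ (Fin n)) c).source → u f = 0) : u = 0 := by
  obtain ⟨p, hp⟩ := SmoothPartitionOfUnity.exists_isSubordinate_chartAt_source (𝓡 n) M
  ext f
  -- By compactness only finitely many partition functions are nonzero, so linearity of `u` suffices
  -- and no continuity is needed.
  have hfin : {i | (Function.support (p i)).Nonempty}.Finite :=
    p.locallyFinite.finite_nonempty_of_compact
  have hsum : f = ∑ i ∈ hfin.toFinset, p i * f := by
    ext x
    have h1 : ∑ i ∈ hfin.toFinset, p i x = 1 := by
      rw [← p.sum_eq_one (mem_univ x)]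
      refine (finsum_eq_sum_of_support_subset _ fun i hi => ?_).symm
      simp only [Finite.coe_toFinset]
      exact ⟨x, hi⟩
    have h2 : (∑ i ∈ hfin.toFinset, p i * f : C^∞⟮𝓡 n, M; ℝ⟯) x =
        ∑ i ∈ hfin.toFinset, p i x * f x := by
      have := map_sum (ContMDiffMap.coeFnAddMonoidHom (I := 𝓡 n) (N := M) (I' := 𝓘(ℝ, ℝ)) (G := ℝ)
        (n := ∞)) (fun i => p i * f) hfin.toFinset
      have := congrFun this x
      simpa using this
    rw [h2, ← Finset.sum_mul, h1, one_mul]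
  rw [hsum, map_sum]
  refine Finset.sum_eq_zero fun i _ => hu i _ ?_
  refine Subset.trans ?_ (hp i)
  exact closure_mono (Function.support_mul_subset_left _ _)

end TestFunctions

/-! ### Limits along an ultrafilter -/

section UltrafilterLimit

/-- The limit of a bounded real sequence along a fixed nonprincipal ultrafilter. -/
def ultraLim (s : ℕ → ℝ) : ℝ := limUnder (hyperfilter ℕ : Filter ℕ) s

theorem tendsto_ultraLim {s : ℕ → ℝ} {C : ℝ} (h : ∀ N, |s N| ≤ C) :
    Tendsto s (hyperfilter ℕ) (𝓝 (ultraLim s)) := by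
  refine tendsto_nhds_limUnder ?_
  obtain ⟨a, -, ha⟩ := (isCompact_Icc (a := -C) (b := C)).ultrafilter_le_nhds
    ((hyperfilter ℕ).map s) (by
      rw [le_principal_iff]
      exact Filter.mem_map.2 (mem_of_superset univ_mem fun N _ => abs_le.1 (h N)))
  exact ⟨a, ha⟩

theorem ultraLim_eq {s : ℕ → ℝ} {a : ℝ} (h : Tendsto s (hyperfilter ℕ) (𝓝 a)) :
    ultraLim s = a := h.limUnder_eq

end UltrafilterLimit

/-! ### The averaging kernel on `ℝ^k` -/

section Kernel

variable (k : ℕ)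

/-- A smooth compactly supported probability density on `ℝ^k`. -/
def meanKernel : EuclideanSpace ℝ (Fin k) → ℝ :=
  (⟨1, 2, by norm_num, by norm_num⟩ : ContDiffBump (0 : EuclideanSpace ℝ (Fin k))).normed volume

theorem meanKernel_nonneg (a : EuclideanSpace ℝ (Fin k)) : 0 ≤ meanKernel k a :=
  ContDiffBump.nonneg_normed _ a

theorem contDiff_meanKernel : ContDiff ℝ ∞ (meanKernel k) := ContDiffBump.contDiff_normed _

theorem continuous_meanKernel : Continuous (meanKernel k) := (contDiff_meanKernel k).continuous

theorem hasCompactSupport_meanKernel : HasCompactSupport (meanKernel k) :=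
  ContDiffBump.hasCompactSupport_normed _

theorem integral_meanKernel : ∫ a, meanKernel k a = 1 := ContDiffBump.integral_normed _

theorem integrable_meanKernel : Integrable (meanKernel k) :=
  (continuous_meanKernel k).integrable_of_hasCompactSupport (hasCompactSupport_meanKernel k)

variable {k}

theorem integrable_meanKernel_mul {F : EuclideanSpace ℝ (Fin k) → ℝ} (hF : Continuous F) :
    Integrable (fun a => meanKernel k a * F a) :=
  ((continuous_meanKernel k).mul hF).integrable_of_hasCompactSupport
    (hasCompactSupport_meanKernel k).mul_right

/-- Continuity of translation in `L¹`, by dominated convergence. The shifts have norm at most `‖b‖`,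
so all integrands live in one ball of radius `R + ‖b‖`. This is the Følner property behind
invariance of the mean. -/
theorem tendsto_integral_abs_meanKernel_sub (b : EuclideanSpace ℝ (Fin k)) :
    Tendsto (fun N : ℕ => ∫ a, |meanKernel k (a - ((N : ℝ) + 1)⁻¹ • b) - meanKernel k a|)
      atTop (𝓝 0) := by
  obtain ⟨C, hC⟩ := (continuous_meanKernel k).bounded_above_of_compact_support
    (hasCompactSupport_meanKernel k)
  obtain ⟨R, hR⟩ := (hasCompactSupport_meanKernel k).isCompact.isBounded.subset_closedBall
    (0 : EuclideanSpace ℝ (Fin k))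
  have hC0 : 0 ≤ C := (norm_nonneg _).trans (hC 0)
  have hzero : ∀ a : EuclideanSpace ℝ (Fin k), R < ‖a‖ → meanKernel k a = 0 := by
    intro a ha
    by_contra h
    have := hR (subset_tsupport _ h)
    rw [mem_closedBall_zero_iff] at this
    linarith
  have hs : ∀ N : ℕ, 0 ≤ ((N : ℝ) + 1)⁻¹ ∧ ((N : ℝ) + 1)⁻¹ ≤ 1 := fun N =>
    ⟨by positivity, inv_le_one_of_one_le₀ (by linarith [N.cast_nonneg (α := ℝ)])⟩
  have hlim := tendsto_integral_of_dominated_convergence (μ := volume)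
    (F := fun (N : ℕ) a => |meanKernel k (a - ((N : ℝ) + 1)⁻¹ • b) - meanKernel k a|)
    (f := fun _ => (0 : ℝ))
    ((Metric.closedBall (0 : EuclideanSpace ℝ (Fin k)) (R + ‖b‖)).indicator fun _ => C + C)
    (fun N => (((continuous_meanKernel k).comp (by fun_prop)).sub
      (continuous_meanKernel k)).abs.aestronglyMeasurable)
    ((integrable_indicator_iff measurableSet_closedBall).2
      (integrableOn_const measure_closedBall_lt_top.ne))
    (fun N => ae_of_all _ fun a => ?_) (ae_of_all _ fun a => ?_)
  · simpa using hlim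
  · rw [Real.norm_eq_abs, abs_abs]
    by_cases ha : a ∈ Metric.closedBall (0 : EuclideanSpace ℝ (Fin k)) (R + ‖b‖)
    · rw [indicator_of_mem ha]
      exact (abs_sub _ _).trans (add_le_add (hC _) (hC _))
    · rw [indicator_of_notMem ha]
      rw [mem_closedBall_zero_iff, not_le] at ha
      have h1 : ‖((N : ℝ) + 1)⁻¹ • b‖ ≤ ‖b‖ := by
        rw [norm_smul, Real.norm_of_nonneg (hs N).1]
        exact mul_le_of_le_one_left (norm_nonneg _) (hs N).2
      have h2 := norm_sub_norm_le a (((N : ℝ) + 1)⁻¹ • b)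
      rw [hzero a (by linarith [norm_nonneg b]), hzero (a - _) (by linarith)]
      simp
  · have h0 : Tendsto (fun N : ℕ => ((N : ℝ) + 1)⁻¹) atTop (𝓝 0) := by
      simpa using tendsto_one_div_add_atTop_nhds_zero_nat (𝕜 := ℝ)
    have h1 : Tendsto (fun N : ℕ => a - ((N : ℝ) + 1)⁻¹ • b) atTop (𝓝 a) := by
      simpa using (h0.smul_const b).const_sub a
    have h2 := (((continuous_meanKernel k).tendsto a).comp h1).sub_const (meanKernel k a)
    simpa using h2.abs

end Kernel

/-! ### Invariant means over orbits -/

section OrbitMean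

/-- The average of `f` over a large part of the orbit of `x`. -/
def orbitAvg (k : ℕ) {M : Type*} [AddAction (EuclideanSpace ℝ (Fin k)) M] (x : M) (N : ℕ)
    (f : M → ℝ) : ℝ :=
  ∫ a : EuclideanSpace ℝ (Fin k), meanKernel k a * f ((((N : ℝ) + 1) • a) +ᵥ x)

theorem orbitAvg_nonneg {k : ℕ} {M : Type*} [AddAction (EuclideanSpace ℝ (Fin k)) M] (x : M)
    (N : ℕ) {f : M → ℝ} (hf : ∀ z, 0 ≤ f z) :
    0 ≤ orbitAvg k x N f :=
  integral_nonneg fun a => mul_nonneg (meanKernel_nonneg k a) (hf _)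

variable {k n : ℕ} {M : Type*} [TopologicalSpace M]
  [ChartedSpace (EuclideanSpace ℝ (Fin n)) M]
  [AddAction (EuclideanSpace ℝ (Fin k)) M]

theorem orbitAvg_smul (x : M) (N : ℕ) (r : ℝ) (f : C^∞⟮𝓡 n, M; ℝ⟯) :
    orbitAvg k x N (r • f : C^∞⟮𝓡 n, M; ℝ⟯) = r * orbitAvg k x N f := by
  unfold orbitAvg
  rw [← integral_const_mul]
  congr 1
  ext a
  exact mul_left_comm (meanKernel k a) r _

theorem abs_orbitAvg_le (x : M) (N : ℕ) (f : C^∞⟮𝓡 n, M; ℝ⟯) {C : ℝ} (hC : ∀ z, |f z| ≤ C) :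
    |orbitAvg k x N f| ≤ C := by
  have h := norm_integral_le_of_norm_le (μ := volume)
    (f := fun a : EuclideanSpace ℝ (Fin k) => meanKernel k a * f ((((N : ℝ) + 1) • a) +ᵥ x))
    ((integrable_meanKernel k).mul_const C) (ae_of_all _ fun a => by
      rw [norm_mul, Real.norm_of_nonneg (meanKernel_nonneg k a)]
      exact mul_le_mul_of_nonneg_left (hC _) (meanKernel_nonneg k a))
  rw [integral_mul_const, integral_meanKernel, one_mul] at h
  exact h

theorem exists_abs_le [CompactSpace M] (f : C^∞⟮𝓡 n, M; ℝ⟯) : ∃ C, ∀ z, |f z| ≤ C := by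
  obtain ⟨C, hC⟩ := isCompact_univ.exists_bound_of_continuousOn f.contMDiff.continuous.continuousOn
  exact ⟨C, fun z => hC z (mem_univ z)⟩

theorem tendsto_orbitAvg [CompactSpace M] (x : M) (f : C^∞⟮𝓡 n, M; ℝ⟯) :
    Tendsto (fun N => orbitAvg k x N f) (hyperfilter ℕ)
      (𝓝 (ultraLim fun N => orbitAvg k x N f)) := by
  obtain ⟨C, hC⟩ := exists_abs_le f
  exact tendsto_ultraLim fun N => abs_orbitAvg_le x N f hC

variable [ContMDiffVAdd (𝓡 k) (𝓡 n) ∞ (EuclideanSpace ℝ (Fin k)) M]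

variable (n) in
theorem contMDiff_vadd_const (b : EuclideanSpace ℝ (Fin k)) :
    ContMDiff (𝓡 n) (𝓡 n) ∞ (fun z : M => b +ᵥ z) :=
  (ContMDiffVAdd.contMDiff_vadd (I := 𝓡 k) (I' := 𝓡 n) (n := ∞)
    (G := EuclideanSpace ℝ (Fin k)) (M := M)).comp (contMDiff_const.prodMk contMDiff_id)

/-- The translate `z ↦ f (b · z)` of a smooth function. -/
def translate (b : EuclideanSpace ℝ (Fin k)) (f : C^∞⟮𝓡 n, M; ℝ⟯) : C^∞⟮𝓡 n, M; ℝ⟯ :=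
  ⟨fun z => f (b +ᵥ z), f.contMDiff.comp (contMDiff_vadd_const n b)⟩

theorem translate_apply (b : EuclideanSpace ℝ (Fin k)) (f : C^∞⟮𝓡 n, M; ℝ⟯) (z : M) :
    translate b f z = f (b +ᵥ z) := rfl

theorem contDiff_orbit (f : C^∞⟮𝓡 n, M; ℝ⟯) (x : M) :
    ContDiff ℝ ∞ (fun a : EuclideanSpace ℝ (Fin k) => f (a +ᵥ x)) := by
  have h := (ContMDiffVAdd.contMDiff_vadd (I := 𝓡 k) (I' := 𝓡 n) (n := ∞)
    (G := EuclideanSpace ℝ (Fin k)) (M := M)).comp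
      ((contMDiff_id (I := 𝓡 k)).prodMk (contMDiff_const (I := 𝓡 k) (I' := 𝓡 n) (c := x)))
  exact (f.contMDiff.comp h).contDiff

theorem fderiv_orbit_single [IsManifold (𝓡 n) ∞ M] (f : C^∞⟮𝓡 n, M; ℝ⟯) (x : M)
    (a : EuclideanSpace ℝ (Fin k)) (i : Fin k) :
    fderiv ℝ (fun a : EuclideanSpace ℝ (Fin k) => f (a +ᵥ x)) a (EuclideanSpace.single i (1 : ℝ)) =
      lieDeriv k i f (a +ᵥ x) := by
  have h1 := mfderiv_generator k i f (a +ᵥ x)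
  have h2 : lieDeriv k i f (a +ᵥ x) = deriv (fun t : ℝ => f ((t • EuclideanSpace.single i (1 : ℝ) :
        EuclideanSpace ℝ (Fin k)) +ᵥ (a +ᵥ x))) 0 := h1
  have hd : HasFDerivAt (fun a : EuclideanSpace ℝ (Fin k) => f (a +ᵥ x))
      (fderiv ℝ (fun a : EuclideanSpace ℝ (Fin k) => f (a +ᵥ x)) a)
      ((0 : ℝ) • EuclideanSpace.single i (1 : ℝ) + a) := by
    rw [zero_smul, zero_add]
    exact ((contDiff_orbit f x).differentiable (by simp) a).hasFDerivAt
  have hl : HasDerivAt (fun t : ℝ => t • EuclideanSpace.single i (1 : ℝ) + a)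
      (EuclideanSpace.single i (1 : ℝ)) 0 := by
    simpa using ((hasDerivAt_id (0 : ℝ)).smul_const
      (EuclideanSpace.single i (1 : ℝ) : EuclideanSpace ℝ (Fin k))).add_const a
  rw [h2]
  simp only [vadd_vadd]
  exact (hd.comp_hasDerivAt 0 hl).deriv.symm

theorem continuous_dilated_orbit (f : C^∞⟮𝓡 n, M; ℝ⟯) (x : M) (s : ℝ) :
    Continuous (fun a : EuclideanSpace ℝ (Fin k) => f ((s • a) +ᵥ x)) :=
  (contDiff_orbit f x).continuous.comp (continuous_const_smul s)

theorem orbitAvg_add (x : M) (N : ℕ) (f g : C^∞⟮𝓡 n, M; ℝ⟯) :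
    orbitAvg k x N (f + g : C^∞⟮𝓡 n, M; ℝ⟯) = orbitAvg k x N f + orbitAvg k x N g := by
  unfold orbitAvg
  rw [← integral_add (integrable_meanKernel_mul (continuous_dilated_orbit f x _))
    (integrable_meanKernel_mul (continuous_dilated_orbit g x _))]
  simp only [← mul_add]
  rfl

/-- After the change of variables, translating `f` by `b` amounts to shifting the kernel by only `b
/ (N + 1)`. -/
theorem abs_orbitAvg_translate_sub_le (x : M) (N : ℕ) (b : EuclideanSpace ℝ (Fin k))
    (f : C^∞⟮𝓡 n, M; ℝ⟯) {C : ℝ} (hC : ∀ z, |f z| ≤ C) :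
    |orbitAvg k x N (translate b f) - orbitAvg k x N f| ≤
      (∫ a, |meanKernel k (a - ((N : ℝ) + 1)⁻¹ • b) - meanKernel k a|) * C := by
  set s : ℝ := (N : ℝ) + 1
  have hs : s ≠ 0 := by positivity
  have h1 : orbitAvg k x N (translate b f) =
      ∫ a : EuclideanSpace ℝ (Fin k), meanKernel k (a - s⁻¹ • b) * f ((s • a) +ᵥ x) := by
    rw [← integral_add_right_eq_self _ (s⁻¹ • b)]
    unfold orbitAvg
    congr 1
    ext a
    rw [add_sub_cancel_right, smul_add, smul_inv_smul₀ hs, translate_apply, vadd_vadd, add_comm b]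
  have hcs : HasCompactSupport (fun a : EuclideanSpace ℝ (Fin k) => meanKernel k (a - s⁻¹ • b)) :=
    (hasCompactSupport_meanKernel k).comp_homeomorph (Homeomorph.subRight (s⁻¹ • b))
  have hcc : Continuous (fun a : EuclideanSpace ℝ (Fin k) => meanKernel k (a - s⁻¹ • b)) :=
    (continuous_meanKernel k).comp (by fun_prop)
  have hi : Integrable (fun a : EuclideanSpace ℝ (Fin k) =>
      meanKernel k (a - s⁻¹ • b) * f ((s • a) +ᵥ x)) :=
    (hcc.mul (continuous_dilated_orbit f x _)).integrable_of_hasCompactSupport hcs.mul_right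
  have hd : Integrable (fun a : EuclideanSpace ℝ (Fin k) =>
      |meanKernel k (a - s⁻¹ • b) - meanKernel k a|) :=
    ((hcc.integrable_of_hasCompactSupport hcs).sub (integrable_meanKernel k)).abs
  rw [h1, orbitAvg, ← integral_sub hi
    (integrable_meanKernel_mul (continuous_dilated_orbit f x _)), ← integral_mul_const]
  refine (Real.norm_eq_abs _).ge.trans (norm_integral_le_of_norm_le (hd.mul_const C)
    (ae_of_all _ fun a => ?_))
  rw [← sub_mul, norm_mul, Real.norm_eq_abs]
  exact mul_le_mul_of_nonneg_left (hC _) (abs_nonneg _)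

/-- Along the dilated orbit, `X_i f` is `(N + 1)⁻¹` times a directional derivative. Integration by
parts moves that derivative to the kernel, leaving a bound that involves only the sup of `f`. -/
theorem abs_orbitAvg_lieDeriv_le [IsManifold (𝓡 n) ∞ M] (x : M) (N : ℕ) (i : Fin k)
    (f : C^∞⟮𝓡 n, M; ℝ⟯) {C : ℝ} (hC : ∀ z, |f z| ≤ C) :
    |orbitAvg k x N (lieDeriv k i f)| ≤ ((N : ℝ) + 1)⁻¹ *
      ((∫ a, |fderiv ℝ (meanKernel k) a (EuclideanSpace.single i (1 : ℝ))|) * C) := by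
  set s : ℝ := (N : ℝ) + 1
  have hs : 0 < s := by positivity
  set e : EuclideanSpace ℝ (Fin k) := EuclideanSpace.single i (1 : ℝ)
  set F : EuclideanSpace ℝ (Fin k) → ℝ := fun a => f ((s • a) +ᵥ x) with hF
  have hFd : ContDiff ℝ ∞ F := (contDiff_orbit f x).comp (contDiff_const_smul s)
  have hFe : ∀ a, fderiv ℝ F a e = s * lieDeriv k i f ((s • a) +ᵥ x) := by
    intro a
    have h1 := fderiv_comp_smul (f := fun a : EuclideanSpace ℝ (Fin k) => f (a +ᵥ x)) s (x := a)
    change fderiv ℝ (fun a => f ((s • a) +ᵥ x)) a e = _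
    rw [h1, smul_apply, fderiv_orbit_single, smul_eq_mul]
  have hK := contDiff_meanKernel k
  have hKe : Continuous fun a => fderiv ℝ (meanKernel k) a e :=
    (hK.continuous_fderiv (by simp)).clm_apply continuous_const
  have hFec : Continuous fun a => fderiv ℝ F a e :=
    (hFd.continuous_fderiv (by simp)).clm_apply continuous_const
  have hKs : HasCompactSupport fun a => fderiv ℝ (meanKernel k) a e :=
    (hasCompactSupport_meanKernel k).fderiv_apply ℝ e
  have hparts := integral_mul_fderiv_eq_neg_fderiv_mul_of_integrable (μ := volume) (v := e)
    (f := meanKernel k) (g := F)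
    ((hKe.mul hFd.continuous).integrable_of_hasCompactSupport hKs.mul_right)
    (integrable_meanKernel_mul hFec) (integrable_meanKernel_mul hFd.continuous)
    (fun a _ => hK.differentiable (by simp) a) (fun a _ => hFd.differentiable (by simp) a)
  have h2 : ∫ a, meanKernel k a * fderiv ℝ F a e = s * orbitAvg k x N (lieDeriv k i f) := by
    rw [orbitAvg, ← integral_const_mul]
    congr 1
    ext a
    rw [hFe]
    ring
  have h3 : |∫ a, fderiv ℝ (meanKernel k) a e * F a| ≤
      (∫ a, |fderiv ℝ (meanKernel k) a e|) * C := by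
    rw [← integral_mul_const]
    refine (Real.norm_eq_abs _).ge.trans (norm_integral_le_of_norm_le
      ((hKe.integrable_of_hasCompactSupport hKs).abs.mul_const C) (ae_of_all _ fun a => ?_))
    rw [norm_mul, Real.norm_eq_abs]
    exact mul_le_mul_of_nonneg_left (hC _) (abs_nonneg _)
  have h4 : orbitAvg k x N (lieDeriv k i f) = s⁻¹ * -∫ a, fderiv ℝ (meanKernel k) a e * F a := by
    rw [← hparts, h2, inv_mul_cancel_left₀ hs.ne']
  rw [h4, abs_mul, abs_neg, abs_of_pos (inv_pos.2 hs)]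
  exact mul_le_mul_of_nonneg_left h3 (inv_pos.2 hs).le

variable [CompactSpace M]

variable (k n) in
/-- An invariant mean over the orbit of `x`, as a linear functional on smooth functions. -/
def orbitMean (x : M) : C^∞⟮𝓡 n, M; ℝ⟯ →ₗ[ℝ] ℝ where
  toFun f := ultraLim fun N => orbitAvg k x N f
  map_add' f g := ultraLim_eq (by
    simp only [orbitAvg_add]
    exact (tendsto_orbitAvg x f).add (tendsto_orbitAvg x g))
  map_smul' r f := ultraLim_eq (by
    simp only [orbitAvg_smul]
    exact (tendsto_orbitAvg x f).const_mul r)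

theorem orbitMean_one (x : M) : orbitMean k n x 1 = 1 := by
  refine ultraLim_eq (tendsto_const_nhds.congr fun N => ?_)
  unfold orbitAvg
  refine (integral_meanKernel k).symm.trans ?_
  congr 1
  ext a
  exact (mul_one _).symm

theorem orbitMean_nonneg (x : M) {f : C^∞⟮𝓡 n, M; ℝ⟯} (hf : ∀ z, 0 ≤ f z) :
    0 ≤ orbitMean k n x f :=
  ge_of_tendsto' (tendsto_orbitAvg x f) fun N => orbitAvg_nonneg x N hf

theorem abs_orbitMean_le (x : M) {f : C^∞⟮𝓡 n, M; ℝ⟯} {C : ℝ} (hC : ∀ z, |f z| ≤ C) :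
    |orbitMean k n x f| ≤ C :=
  le_of_tendsto' (tendsto_orbitAvg x f).abs fun N => abs_orbitAvg_le x N f hC

/-- The mean sees only the orbit of `x`; this confines its support to any closed invariant set
containing `x`. -/
theorem orbitMean_eq_zero (x : M) {f : C^∞⟮𝓡 n, M; ℝ⟯}
    (hf : ∀ a : EuclideanSpace ℝ (Fin k), f (a +ᵥ x) = 0) : orbitMean k n x f = 0 := by
  refine ultraLim_eq (tendsto_const_nhds.congr fun N => ?_)
  simp [orbitAvg, hf]

theorem orbitMean_translate (x : M) (b : EuclideanSpace ℝ (Fin k)) (f : C^∞⟮𝓡 n, M; ℝ⟯) :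
    orbitMean k n x (translate b f) = orbitMean k n x f := by
  obtain ⟨C, hC⟩ := exists_abs_le f
  have h1 : Tendsto (fun N => orbitAvg k x N (translate b f) - orbitAvg k x N f) atTop (𝓝 0) := by
    refine squeeze_zero_norm (fun N => abs_orbitAvg_translate_sub_le x N b f hC) ?_
    simpa using (tendsto_integral_abs_meanKernel_sub b).mul_const C
  have h2 := tendsto_nhds_unique (h1.mono_left Nat.hyperfilter_le_atTop)
    ((tendsto_orbitAvg x (translate b f)).sub (tendsto_orbitAvg x f))
  exact sub_eq_zero.1 h2.symm

theorem orbitMean_lieDeriv [IsManifold (𝓡 n) ∞ M] (x : M) (i : Fin k) (f : C^∞⟮𝓡 n, M; ℝ⟯) :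
    orbitMean k n x (lieDeriv k i f) = 0 := by
  obtain ⟨C, hC⟩ := exists_abs_le f
  refine ultraLim_eq (Tendsto.mono_left ?_ Nat.hyperfilter_le_atTop)
  refine squeeze_zero_norm (fun N => abs_orbitAvg_lieDeriv_le x N i f hC) ?_
  have h0 : Tendsto (fun N : ℕ => ((N : ℝ) + 1)⁻¹) atTop (𝓝 0) := by
    simpa using tendsto_one_div_add_atTop_nhds_zero_nat (𝕜 := ℝ)
  simpa using h0.mul_const _

/-- The `C^∞` topology is finer than the topology of uniform convergence. -/
theorem eventually_abs_sub_lt (f : C^∞⟮𝓡 n, M; ℝ⟯) {ε : ℝ} (hε : 0 < ε) :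
    ∀ᶠ g in 𝓝 f, ∀ z, |g z - f z| < ε := by
  have hloc : ∀ x : M, ∃ W ∈ 𝓝 x, ∀ᶠ g : C^∞⟮𝓡 n, M; ℝ⟯ in 𝓝 f, ∀ z ∈ W, |g z - f z| < ε := by
    intro x
    set φ := chartAt (EuclideanSpace ℝ (Fin n)) x
    have hx : x ∈ φ.source := mem_chart_source _ x
    obtain ⟨K, hK, hKt, hKc⟩ := local_compact_nhds (φ.open_target.mem_nhds (φ.map_source hx))
    -- Order `m = 0` of the `C^∞` topology suffices: a multilinear map in no variables is its value
    -- on the empty tuple.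
    have hcont : Continuous (fun f : C^∞⟮𝓡 n, M; ℝ⟯ => UniformOnFun.ofFun
        {K | IsCompact K ∧ K ⊆ φ.target}
        (iteratedFDeriv ℝ 0 (fun y => f (φ.symm y)))) :=
      continuous_iInf_dom (i := x) (continuous_iInf_dom (i := 0) continuous_induced_dom)
    have h1 := UniformOnFun.tendsto_iff_tendstoUniformlyOn.1 (hcont.tendsto f) K ⟨hKc, hKt⟩
    rw [Metric.tendstoUniformlyOn_iff] at h1
    refine ⟨φ.source ∩ φ ⁻¹' K, inter_mem (φ.open_source.mem_nhds hx)
      (φ.continuousAt hx |>.preimage_mem_nhds hK), ?_⟩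
    filter_upwards [h1 ε hε] with g hg z hz
    have h2 := hg (φ z) hz.2
    have h3 : dist (f (φ.symm (φ z))) (g (φ.symm (φ z))) < ε := by
      refine lt_of_le_of_lt ?_ h2
      have h4 := ContinuousMultilinearMap.le_opNorm
        (iteratedFDeriv ℝ 0 (fun y => f (φ.symm y)) (φ z) -
          iteratedFDeriv ℝ 0 (fun y => g (φ.symm y)) (φ z)) 0
      rw [dist_eq_norm]
      simpa [dist_eq_norm] using h4
    rw [φ.left_inv hz.1, dist_comm, Real.dist_eq] at h3
    exact h3
  choose W hW hWe using hloc
  obtain ⟨t, ht⟩ := CompactSpace.elim_nhds_subcover W hW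
  filter_upwards [(Filter.eventually_all_finset t).2 fun x _ => hWe x] with g hg z
  have hz : z ∈ ⋃ x ∈ t, W x := ht ▸ mem_univ z
  obtain ⟨x, hxt, hzx⟩ := mem_iUnion₂.1 hz
  exact hg x hxt z hzx

variable (k n) in
/-- The invariant mean over the orbit of `x`, as a distribution. -/
def orbitDistribution (x : M) : Distribution n M where
  toLinearMap := orbitMean k n x
  cont := by
    rw [continuous_iff_continuousAt]
    intro f
    rw [ContinuousAt, Metric.tendsto_nhds]
    intro ε hε
    filter_upwards [eventually_abs_sub_lt f (half_pos hε)] with g hg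
    refine lt_of_le_of_lt ?_ (half_lt_self hε)
    change |orbitMean k n x g - orbitMean k n x f| ≤ _
    rw [← map_sub]
    exact abs_orbitMean_le x fun z => (hg z).le

end OrbitMean

/-! ### Functionals given by smooth densities -/

section Representation

variable {n : ℕ} {M : Type*} [TopologicalSpace M] [ChartedSpace (EuclideanSpace ℝ (Fin n)) M]

/-- The functional `u` is integration against the smooth density `μ`. -/
def IsRepresentedBy (u : C^∞⟮𝓡 n, M; ℝ⟯ →ₗ[ℝ] ℝ)
    (μ : ∀ x : M, (Fin n → TangentSpace (𝓡 n) x) → ℝ) : Prop :=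
  IsSmoothDensity μ ∧ ∀ (c : M) (f : C^∞⟮𝓡 n, M; ℝ⟯),
    tsupport f ⊆ (chartAt (EuclideanSpace ℝ (Fin n)) c).source →
    u f = ∫ y, chartIntegrand c f (chartDensity μ c) y

theorem IsSmoothFunctional.exists_isRepresentedBy {u : C^∞⟮𝓡 n, M; ℝ⟯ →ₗ[ℝ] ℝ}
    (hu : IsSmoothFunctional u) : ∃ μ, IsRepresentedBy u μ := by
  obtain ⟨μ, hμ, h⟩ := hu
  refine ⟨μ, hμ, fun c f hf => ?_⟩
  rw [h c f hf, integral_chartIntegrand]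
  rfl

theorem isSmoothFunctional_zero :
    IsSmoothFunctional (0 : C^∞⟮𝓡 n, M; ℝ⟯ →ₗ[ℝ] ℝ) := by
  refine ⟨fun _ _ => 0, ⟨fun _ _ _ => (mul_zero _).symm, fun _ => contDiffOn_const⟩, ?_⟩
  intro c f _
  simp

theorem IsSmoothDensity.chartDensity_pos [IsManifold (𝓡 n) ∞ M]
    {μ : ∀ x : M, (Fin n → TangentSpace (𝓡 n) x) → ℝ} (hμ : IsSmoothDensity μ)
    (hpos : ∀ x, 0 < frameValue μ x)
    {c : M} {y : EuclideanSpace ℝ (Fin n)}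
    (hy : y ∈ (chartAt (EuclideanSpace ℝ (Fin n)) c).target) : 0 < chartDensity μ c y := by
  rw [hμ.chartDensity_eq]
  exact mul_pos (abs_pos.2 (symmJac_ne_zero (chart_mem_maximalAtlas c) hy)) (hpos _)

variable {u v : C^∞⟮𝓡 n, M; ℝ⟯ →ₗ[ℝ] ℝ}
  {μ ν : ∀ x : M, (Fin n → TangentSpace (𝓡 n) x) → ℝ}
  [CompactSpace M] [T2Space M] [IsManifold (𝓡 n) ∞ M]

theorem IsRepresentedBy.frameValue_eq_zero (h : IsRepresentedBy u μ) {W : Set M} (hW : IsOpen W)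
    (hu : ∀ f : C^∞⟮𝓡 n, M; ℝ⟯, tsupport f ⊆ W → u f = 0) {x : M} (hx : x ∈ W) :
    frameValue μ x = 0 := by
  set φ := chartAt (EuclideanSpace ℝ (Fin n)) x
  have hxs : x ∈ φ.source := mem_chart_source _ x
  have hV : IsOpen (φ.target ∩ φ.symm ⁻¹' W) := φ.isOpen_inter_preimage_symm hW
  have hy : φ x ∈ φ.target ∩ φ.symm ⁻¹' W := by
    refine ⟨φ.map_source hxs, ?_⟩
    rw [mem_preimage, φ.left_inv hxs]
    exact hx
  have h1 := eqOn_of_integral_chartIntegrand_eq (H := fun _ => 0) hV inter_subset_left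
    ((h.1.contDiffOn_chartDensity x).continuousOn.mono inter_subset_left) continuousOn_const
    (fun f hf hfV => by
      rw [← h.2 x f hf, hu f fun z hz => by
        have := (hfV hz).2
        rwa [mem_preimage, φ.left_inv (hf hz)] at this]
      simp [chartIntegrand]) hy
  simp only at h1
  rwa [h.1.chartDensity_eq_zero_iff hy.1, φ.left_inv hxs] at h1

theorem IsRepresentedBy.frameValue_nonneg (h : IsRepresentedBy u μ)
    (hu : ∀ f : C^∞⟮𝓡 n, M; ℝ⟯, (∀ z, 0 ≤ f z) → 0 ≤ u f) (x : M) : 0 ≤ frameValue μ x := by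
  set φ := chartAt (EuclideanSpace ℝ (Fin n)) x
  have hxs : x ∈ φ.source := mem_chart_source _ x
  have hy : φ x ∈ φ.target := φ.map_source hxs
  have h1 := nonneg_of_integral_chartIntegrand_nonneg φ.open_target Subset.rfl
    (h.1.contDiffOn_chartDensity x).continuousOn (fun f hf0 hf _ => by
      rw [← h.2 x f hf]
      exact hu f hf0) hy
  rw [h.1.chartDensity_eq, φ.left_inv hxs] at h1
  exact nonneg_of_mul_nonneg_right h1 (abs_pos.2 (symmJac_ne_zero (chart_mem_maximalAtlas x) hy))

theorem IsRepresentedBy.eq_zero (h : IsRepresentedBy u μ) (hμ : ∀ x, frameValue μ x = 0) :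
    u = 0 := by
  refine eq_zero_of_forall_chart_supported u fun c f hf => ?_
  rw [h.2 c f hf]
  have h0 : chartDensity μ c = fun _ => 0 := by
    ext y
    rw [h.1.chartDensity_eq, hμ, mul_zero]
  simp [h0, chartIntegrand]

/-- A positive functional with positive density is faithful. -/
theorem IsRepresentedBy.eq_zero_of_nonneg (h : IsRepresentedBy u μ)
    (hpos : ∀ x, 0 < frameValue μ x)
    (hu : ∀ f : C^∞⟮𝓡 n, M; ℝ⟯, (∀ z, 0 ≤ f z) → 0 ≤ u f) {f : C^∞⟮𝓡 n, M; ℝ⟯}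
    (hf : ∀ z, 0 ≤ f z) (huf : u f = 0) (x : M) : f x = 0 := by
  by_contra hfx
  set φ := chartAt (EuclideanSpace ℝ (Fin n)) x
  obtain ⟨p, hp0, hp1, hpx, hps⟩ := exists_smooth_bump (n := n)
    (φ.open_source.mem_nhds (mem_chart_source (EuclideanSpace ℝ (Fin n)) x))
  have hs : tsupport (p * f : C^∞⟮𝓡 n, M; ℝ⟯) ⊆ φ.source :=
    (closure_mono (Function.support_mul_subset_left _ _)).trans hps
  -- The bump cuts `f` down to one chart, where positivity of the integral is visible; the remainder
  -- `f - p * f` is still nonnegative.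
  have h1 : 0 < u (p * f) := by
    rw [h.2 x _ hs]
    refine integral_chartIntegrand_pos (ContMDiffMap.contMDiff _).continuous hs φ.open_target
      (fun z hz => φ.map_source (hs hz)) (h.1.contDiffOn_chartDensity x).continuousOn
      (fun y hy => h.1.chartDensity_pos hpos hy) (fun z => mul_nonneg (hp0 z) (hf z)) (x := x) ?_
    change p x * f x ≠ 0
    rwa [hpx, one_mul]
  have h2 : 0 ≤ u (f - p * f) := hu _ fun z => by
    change 0 ≤ f z - p z * f z
    linarith [mul_le_mul_of_nonneg_right (hp1 z) (hf z)]
  rw [map_sub, huf] at h2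
  linarith

/-- The ratio of a smooth density and a positive smooth density. -/
def densityRatio (hμ : IsSmoothDensity μ) (hν : IsSmoothDensity ν)
    (hpos : ∀ x, 0 < frameValue μ x) : C^∞⟮𝓡 n, M; ℝ⟯ :=
  ⟨fun x => frameValue ν x / frameValue μ x, by
    intro x
    set φ := chartAt (EuclideanSpace ℝ (Fin n)) x
    have hxs : x ∈ φ.source := mem_chart_source _ x
    have hy : φ x ∈ φ.target := φ.map_source hxs
    have h1 : ContDiffAt ℝ ∞ (fun y => chartDensity ν x y / chartDensity μ x y) (φ x) :=
      ((hν.contDiffOn_chartDensity x).contDiffAt (φ.open_target.mem_nhds hy)).div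
        ((hμ.contDiffOn_chartDensity x).contDiffAt (φ.open_target.mem_nhds hy))
        (hμ.chartDensity_pos hpos hy).ne'
    have h2 : ContMDiffAt (𝓡 n) 𝓘(ℝ, ℝ) ∞
        (fun z => chartDensity ν x (φ z) / chartDensity μ x (φ z)) x :=
      h1.contMDiffAt.comp x (contMDiffAt_of_mem_maximalAtlas (chart_mem_maximalAtlas x) hxs)
    refine h2.congr_of_eventuallyEq ?_
    filter_upwards [φ.open_source.mem_nhds hxs] with z hz
    rw [hμ.chartDensity_div hν (φ.map_source hz), φ.left_inv hz]⟩

/-- A smooth Radon–Nikodym formula: the integrands agree in each chart, and chart-supported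
functions determine a linear functional. -/
theorem IsRepresentedBy.eq_densityRatio_mul (h : IsRepresentedBy u μ) (h' : IsRepresentedBy v ν)
    (hpos : ∀ x, 0 < frameValue μ x) (f : C^∞⟮𝓡 n, M; ℝ⟯) :
    v f = u (densityRatio h.1 h'.1 hpos * f) := by
  set r := densityRatio h.1 h'.1 hpos
  have hz : v - u ∘ₗ LinearMap.mulLeft ℝ r = 0 := by
    refine eq_zero_of_forall_chart_supported _ fun c f hf => ?_
    have hs : tsupport (r * f : C^∞⟮𝓡 n, M; ℝ⟯) ⊆ (chartAt (EuclideanSpace ℝ (Fin n)) c).source :=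
      (closure_mono (Function.support_mul_subset_right _ _)).trans hf
    change v f - u (r * f) = 0
    rw [h.2 c _ hs, h'.2 c f hf, sub_eq_zero]
    congr 1
    ext y
    unfold chartIntegrand
    by_cases hy : y ∈ (chartAt (EuclideanSpace ℝ (Fin n)) c).target
    · rw [indicator_of_mem hy, indicator_of_mem hy]
      have h1 := h.1.chartDensity_div h'.1 hy
      rw [div_eq_iff (h.1.chartDensity_pos hpos hy).ne'] at h1
      rw [h1]
      change f _ * _ = (frameValue ν _ / frameValue μ _) * f _ * _
      ring
    · rw [indicator_of_notMem hy, indicator_of_notMem hy]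
  have := LinearMap.congr_fun hz f
  exact sub_eq_zero.1 this

variable {k : ℕ} [AddAction (EuclideanSpace ℝ (Fin k)) M]
  [ContMDiffVAdd (𝓡 k) (𝓡 n) ∞ (EuclideanSpace ℝ (Fin k)) M]

/-- The density of an invariant functional is invariant. -/
theorem IsRepresentedBy.abs_mapJac_mul_frameValue (h : IsRepresentedBy u μ)
    (b : EuclideanSpace ℝ (Fin k)) (hu : ∀ f : C^∞⟮𝓡 n, M; ℝ⟯, u (translate b f) = u f) (x : M) :
    |mapJac n (fun z : M => b +ᵥ z) x| * frameValue μ (b +ᵥ x) = frameValue μ x := by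
  set φ := chartAt (EuclideanSpace ℝ (Fin n)) x with hφdef
  set ψ := chartAt (EuclideanSpace ℝ (Fin n)) (b +ᵥ x) with hψdef
  have hφ : φ ∈ maximalAtlas (𝓡 n) ∞ M := chart_mem_maximalAtlas x
  have hψ : ψ ∈ maximalAtlas (𝓡 n) ∞ M := chart_mem_maximalAtlas _
  have hb : ContMDiff (𝓡 n) (𝓡 n) ∞ (fun z : M => b +ᵥ z) := contMDiff_vadd_const n b
  have hxs : x ∈ φ.source := mem_chart_source _ x
  -- `V` is the set of coordinates of points near `x` that the translation sends into the second
  -- chart, and `Ψ` below is the translation in coordinates.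
  set V := φ.target ∩ φ.symm ⁻¹' ((fun z : M => b +ᵥ z) ⁻¹' ψ.source) with hVdef
  have hV : IsOpen V := φ.isOpen_inter_preimage_symm (ψ.open_source.preimage hb.continuous)
  set Ψ : EuclideanSpace ℝ (Fin n) → EuclideanSpace ℝ (Fin n) := fun y => ψ (b +ᵥ φ.symm y) with hΨ
  have hΨd : ∀ y ∈ V, ContDiffAt ℝ ∞ Ψ y := fun y hy => contDiffAt_coord hφ hψ hb hy.1 hy.2
  have hΨt : ∀ y ∈ V, Ψ y ∈ ψ.target := fun y hy => ψ.map_source hy.2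
  have hinj : InjOn Ψ V := by
    intro y hy z hz hyz
    have h1 := ψ.injOn hy.2 hz.2 hyz
    exact φ.symm.injOn hy.1 hz.1 (vadd_left_cancel b h1)
  have hxV : φ x ∈ V := by
    refine ⟨φ.map_source hxs, ?_⟩
    rw [mem_preimage, φ.left_inv hxs]
    exact mem_chart_source _ (b +ᵥ x)
  -- `H` is the coordinate expression of the density pulled back by the translation. Testing against
  -- functions supported over `V` identifies it with the original density.
  set H : EuclideanSpace ℝ (Fin n) → ℝ := fun y =>
    |(fderiv ℝ Ψ y).det| * chartDensity μ (b +ᵥ x) (Ψ y) with hH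
  have hHc : ContinuousOn H V := by
    intro y hy
    refine ContinuousAt.continuousWithinAt ?_
    exact (continuousAt_det_fderiv (hΨd y hy)).abs.mul
      (((h.1.contDiffOn_chartDensity _).continuousOn.continuousAt
        (ψ.open_target.mem_nhds (hΨt y hy))).comp (hΨd y hy).continuousAt)
  have key : EqOn (chartDensity μ x) H V := by
    refine eqOn_of_integral_chartIntegrand_eq hV inter_subset_left
      ((h.1.contDiffOn_chartDensity x).continuousOn.mono inter_subset_left) hHc
      fun f hf hfV => ?_
    set g : C^∞⟮𝓡 n, M; ℝ⟯ := translate (-b) f with hg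
    have hgf : translate b g = f := by
      ext z
      rw [translate_apply, hg, translate_apply, neg_vadd_vadd]
    have hgs : ∀ z ∈ tsupport g, -b +ᵥ z ∈ tsupport f := by
      intro z hz
      have hcl : IsClosed ((fun z : M => -b +ᵥ z) ⁻¹' tsupport f) :=
        (isClosed_tsupport f).preimage (contMDiff_vadd_const n (-b)).continuous
      have hsub : Function.support g ⊆ (fun z : M => -b +ᵥ z) ⁻¹' tsupport f := by
        intro w hw
        have h0 : f (-b +ᵥ w) ≠ 0 := hw
        exact subset_tsupport f (Function.mem_support.2 h0)
      exact closure_minimal hsub hcl hz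
    have hgV : ∀ z ∈ tsupport g, ∃ y ∈ V, φ.symm y = -b +ᵥ z := fun z hz =>
      ⟨φ (-b +ᵥ z), hfV (hgs z hz), φ.left_inv (hf (hgs z hz))⟩
    have hgψ : tsupport g ⊆ ψ.source := by
      intro z hz
      obtain ⟨y, hy, hyz⟩ := hgV z hz
      have := hy.2
      rw [mem_preimage, mem_preimage, hyz, vadd_neg_vadd] at this
      exact this
    have h1 : ∫ y, chartIntegrand (b +ᵥ x) g (chartDensity μ (b +ᵥ x)) y =
        ∫ y in Ψ '' V, chartIntegrand (b +ᵥ x) g (chartDensity μ (b +ᵥ x)) y := by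
      refine (setIntegral_eq_integral_of_forall_compl_eq_zero fun y hy => ?_).symm
      refine chartIntegrand_eq_zero fun hy' => hy ?_
      obtain ⟨z, hz, rfl⟩ := hy'
      obtain ⟨y, hy, hyz⟩ := hgV z hz
      refine ⟨y, hy, ?_⟩
      rw [hΨ]
      simp only [hyz, vadd_neg_vadd]
      rfl
    have h2 : ∫ y, chartIntegrand x f H y = ∫ y in V, chartIntegrand x f H y := by
      refine (setIntegral_eq_integral_of_forall_compl_eq_zero fun y hy => ?_).symm
      refine chartIntegrand_eq_zero fun hy' => hy ?_
      obtain ⟨z, hz, rfl⟩ := hy'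
      exact hfV hz
    -- Invariance trades `f` for `g`, integrated in the second chart; the change of variables `Ψ`
    -- brings the integral back to `V`.
    rw [← h.2 x f hf, ← hgf, hu, h.2 _ g hgψ, h1, hgf, h2,
      integral_image_eq_integral_abs_det_fderiv_smul volume hV.measurableSet
        (fun y hy => ((hΨd y hy).differentiableAt (by simp)).hasFDerivAt.hasFDerivWithinAt) hinj]
    refine setIntegral_congr_fun hV.measurableSet fun y hy => ?_
    have hgy : g (ψ.symm (Ψ y)) = f (φ.symm y) := by
      rw [hΨ]
      simp only
      rw [ψ.left_inv hy.2, hg, translate_apply, neg_vadd_vadd]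
    simp only [chartIntegrand]
    rw [indicator_of_mem (hΨt y hy), indicator_of_mem hy.1, hgy, hH, smul_eq_mul]
    ring
  -- The coordinate identity at `φ x` becomes one between frame values through the chain rule for
  -- Jacobians, after cancelling `|symmJac φ (φ x)|`.
  have h1 := key hxV
  have h2 := mapJac_mul_symmJac hφ hψ hb hxV.1 hxV.2
  have h3 : symmJac φ (φ x) ≠ 0 := symmJac_ne_zero hφ hxV.1
  have h4 : ψ.symm (Ψ (φ x)) = b +ᵥ x := by
    rw [hΨ]
    simp only
    rw [ψ.left_inv hxV.2, φ.left_inv hxs]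
  rw [hH] at h1
  simp only at h1
  rw [h.1.chartDensity_eq, h.1.chartDensity_eq, ← hφdef, ← hψdef, h4, φ.left_inv hxs] at h1
  rw [φ.left_inv hxs] at h2
  have h5 := congrArg abs h2
  rw [abs_mul, abs_mul] at h5
  have h6 : Ψ (φ x) = ψ (b +ᵥ x) := by
    rw [hΨ]
    simp only
    rw [φ.left_inv hxs]
  rw [h6] at h1
  refine mul_left_cancel₀ (abs_ne_zero.2 h3) ?_
  rw [h1, ← mul_assoc, mul_comm |symmJac φ (φ x)|, h5]
  ring

end Representation

/-! ### Minimality and uniqueness of the invariant distribution -/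

section Invariant

variable {k n : ℕ} {M : Type*} [TopologicalSpace M] [ChartedSpace (EuclideanSpace ℝ (Fin n)) M]
  [AddAction (EuclideanSpace ℝ (Fin k)) M]
  [ContMDiffVAdd (𝓡 k) (𝓡 n) ∞ (EuclideanSpace ℝ (Fin k)) M] [IsManifold (𝓡 n) ∞ M]

/-- Under global hypoellipticity, invariant distributions are smooth. -/
theorem IsGloballyHypoelliptic.isSmoothFunctional (hGH : IsGloballyHypoelliptic k n M)
    {D : Distribution n M} (hD : ∀ (i : Fin k) f, D (lieDeriv k i f) = 0) :
    IsSmoothFunctional (D : C^∞⟮𝓡 n, M; ℝ⟯ →ₗ[ℝ] ℝ) := by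
  refine hGH D ?_
  have : (D : C^∞⟮𝓡 n, M; ℝ⟯ →ₗ[ℝ] ℝ) ∘ₗ leafwiseLaplacian k n M = 0 := by
    ext f
    simp only [leafwiseLaplacian, LinearMap.comp_apply, LinearMap.sum_apply, map_sum]
    exact Finset.sum_eq_zero fun i _ => hD i _
  rw [this]
  exact isSmoothFunctional_zero

theorem lieDeriv_mul (i : Fin k) (f g : C^∞⟮𝓡 n, M; ℝ⟯) :
    lieDeriv k i (f * g) = f * lieDeriv k i g + lieDeriv k i f * g := by
  ext x
  have h : ∀ f : C^∞⟮𝓡 n, M; ℝ⟯, lieDeriv k i f x =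
      fderiv ℝ (fun a : EuclideanSpace ℝ (Fin k) => f (a +ᵥ x)) 0
        (EuclideanSpace.single i (1 : ℝ)) := fun f => by
    rw [fderiv_orbit_single, zero_vadd]
  have hd : ∀ f : C^∞⟮𝓡 n, M; ℝ⟯,
      DifferentiableAt ℝ (fun a : EuclideanSpace ℝ (Fin k) => f (a +ᵥ x)) 0 := fun f =>
    (contDiff_orbit f x).differentiable (by simp) 0
  change lieDeriv k i (f * g) x = f x * lieDeriv k i g x + lieDeriv k i f x * g x
  have hm := congrArg (fun L => L (EuclideanSpace.single i (1 : ℝ))) (fderiv_fun_mul (hd f) (hd g))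
  rw [h, h, h]
  refine hm.trans ?_
  simp only [zero_vadd, add_apply, smul_apply, smul_eq_mul]
  ring

variable [CompactSpace M]

theorem IsGloballyHypoelliptic.exists_isRepresentedBy_orbitMean
    (hGH : IsGloballyHypoelliptic k n M) (x : M) : ∃ μ, IsRepresentedBy (orbitMean k n x) μ :=
  (hGH.isSmoothFunctional (D := orbitDistribution k n x)
    fun i f => orbitMean_lieDeriv x i f).exists_isRepresentedBy

variable [T2Space M]

/-- The mean over an orbit in `Z` has a smooth density vanishing off `Z`. Were `Zᶜ` dense, the
density would vanish identically, contradicting total mass `1`. -/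
theorem IsGloballyHypoelliptic.nonempty_interior (hGH : IsGloballyHypoelliptic k n M) {Z : Set M}
    (hZ : IsClosed Z) (hinv : ∀ (a : EuclideanSpace ℝ (Fin k)), ∀ x ∈ Z, a +ᵥ x ∈ Z)
    (hne : Z.Nonempty) : (interior Z).Nonempty := by
  obtain ⟨x, hx⟩ := hne
  obtain ⟨μ, hμ⟩ := hGH.exists_isRepresentedBy_orbitMean x
  by_contra hint
  rw [not_nonempty_iff_eq_empty, interior_eq_empty_iff_dense_compl] at hint
  have h0 : Zᶜ ⊆ {z : M | frameValue μ z = 0} := fun z hz =>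
    hμ.frameValue_eq_zero hZ.isOpen_compl (fun f hf => orbitMean_eq_zero x fun a => by
      by_contra hfa
      exact hf (subset_tsupport f hfa) (hinv a x hx)) hz
  have h1 : ∀ z, frameValue μ z = 0 := fun z =>
    (isClosed_frameValue_eq_zero hμ.1).closure_subset_iff.2 h0 (hint z)
  have h2 := orbitMean_one (k := k) (n := n) x
  rw [hμ.eq_zero h1] at h2
  exact zero_ne_one h2

/-- Under global hypoellipticity, the action is minimal. -/
theorem IsGloballyHypoelliptic.eq_univ [ConnectedSpace M] (hGH : IsGloballyHypoelliptic k n M)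
    {Z : Set M} (hZ : IsClosed Z) (hinv : ∀ (a : EuclideanSpace ℝ (Fin k)), ∀ x ∈ Z, a +ᵥ x ∈ Z)
    (hne : Z.Nonempty) : Z = univ := by
  have hfr : frontier Z = ∅ := by
    by_contra hfr
    have h1 := hGH.nonempty_interior (Z := frontier Z) isClosed_frontier (fun a x hx => ?_)
      (nonempty_iff_ne_empty.2 hfr)
    · rw [interior_frontier hZ] at h1
      exact not_nonempty_empty h1
    -- The frontier is invariant: if a translate of `x` were interior to `Z`, pulling the interior
    -- back by the homeomorphism would make `x` interior too.
    · rw [hZ.frontier_eq] at hx ⊢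
      refine ⟨hinv a x hx.1, fun hint => hx.2 ?_⟩
      have hopen : IsOpen ((fun z : M => a +ᵥ z) ⁻¹' interior Z) :=
        isOpen_interior.preimage (contMDiff_vadd_const n a).continuous
      refine mem_interior.2 ⟨_, fun z hz => ?_, hopen, hint⟩
      have := hinv (-a) _ (interior_subset hz)
      rwa [neg_vadd_vadd] at this
  exact (isClopen_iff_frontier_eq_empty.2 hfr).eq_univ hne

/-- Positivity of the mean gives `≥ 0`. The zero set is closed, and invariant because the density
is, so by minimality a single zero would force the mean to vanish. -/
theorem IsGloballyHypoelliptic.frameValue_pos [ConnectedSpace M]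
    (hGH : IsGloballyHypoelliptic k n M) {x : M}
    {μ : ∀ x : M, (Fin n → TangentSpace (𝓡 n) x) → ℝ}
    (hμ : IsRepresentedBy (orbitMean k n x) μ) (z : M) : 0 < frameValue μ z := by
  refine lt_of_le_of_ne (hμ.frameValue_nonneg (fun f hf => orbitMean_nonneg x hf) z) fun hz => ?_
  have h1 := hGH.eq_univ (isClosed_frameValue_eq_zero hμ.1) (fun a y hy => ?_) ⟨z, hz.symm⟩
  · have h2 := orbitMean_one (k := k) (n := n) x
    rw [hμ.eq_zero fun y => h1.ge (mem_univ y)] at h2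
    exact zero_ne_one h2
  · have h3 := hμ.abs_mapJac_mul_frameValue (-a) (orbitMean_translate x (-a)) (a +ᵥ y)
    rw [neg_vadd_vadd, show frameValue μ y = 0 from hy, mul_zero] at h3
    exact h3.symm

/-- Such an `h` is constant along orbits, so its level sets are closed and invariant, and minimality
applies. -/
theorem IsGloballyHypoelliptic.eq_const [ConnectedSpace M] (hGH : IsGloballyHypoelliptic k n M)
    {h : C^∞⟮𝓡 n, M; ℝ⟯} (hh : ∀ (i : Fin k) x, lieDeriv k i h x = 0) (x y : M) : h y = h x := by
  have hconst : ∀ (z : M) (a : EuclideanSpace ℝ (Fin k)), h (a +ᵥ z) = h z := by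
    intro z a
    have h1 := is_const_of_fderiv_eq_zero (𝕜 := ℝ)
      (f := fun a : EuclideanSpace ℝ (Fin k) => h (a +ᵥ z))
      ((contDiff_orbit h z).differentiable (by simp)) (fun a => ?_) a 0
    · simpa using h1
    · ext1 w
      have : (fderiv ℝ (fun a : EuclideanSpace ℝ (Fin k) => h (a +ᵥ z)) a :
          EuclideanSpace ℝ (Fin k) →ₗ[ℝ] ℝ) = 0 := by
        refine (EuclideanSpace.basisFun (Fin k) ℝ).toBasis.ext fun i => ?_
        have h2 := fderiv_orbit_single h z a i
        rw [hh] at h2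
        simpa using h2
      exact LinearMap.congr_fun this w
  have h2 := hGH.eq_univ (Z := {z | h z = h x})
    (isClosed_eq h.contMDiff.continuous continuous_const)
    (fun a z hz => (hconst z a).trans hz) ⟨x, rfl⟩
  exact h2.ge (mem_univ y)

/-- Under global hypoellipticity, every invariant distribution is a multiple of the invariant
mean. -/
theorem IsGloballyHypoelliptic.exists_eq_smul [ConnectedSpace M]
    (hGH : IsGloballyHypoelliptic k n M) (x : M) {D : Distribution n M}
    (hD : ∀ (i : Fin k) f, D (lieDeriv k i f) = 0) :
    ∃ r : ℝ, r • orbitDistribution k n x = D := by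
  obtain ⟨μ, hμ⟩ := hGH.exists_isRepresentedBy_orbitMean x
  obtain ⟨ν, hν⟩ := (hGH.isSmoothFunctional hD).exists_isRepresentedBy
  have hpos := hGH.frameValue_pos hμ
  set h := densityRatio hμ.1 hν.1 hpos
  have hrep : ∀ f, D f = orbitMean k n x (h * f) := hμ.eq_densityRatio_mul hν hpos
  have hh : ∀ (i : Fin k) z, lieDeriv k i h z = 0 := by
    intro i z
    -- Expand the mean of `X_i (h · X_i h)`, which is zero, by Leibniz: the term `h · X_i X_i h` has
    -- mean `D (X_i X_i h) = 0`, leaving the square.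
    have h1 : orbitMean k n x (lieDeriv k i h * lieDeriv k i h) = 0 := by
      have h2 := hD i (lieDeriv k i h)
      have h3 := orbitMean_lieDeriv (n := n) x i (h * lieDeriv k i h)
      rw [lieDeriv_mul, map_add, ← hrep, h2, zero_add] at h3
      exact h3
    exact mul_self_eq_zero.1 (hμ.eq_zero_of_nonneg hpos (fun f hf => orbitMean_nonneg x hf)
      (fun z => mul_self_nonneg (lieDeriv k i h z)) h1 z)
  refine ⟨h x, ?_⟩
  ext f
  have h4 : h * f = h x • f := by
    ext z
    exact congrArg (· * f z) (hGH.eq_const hh x z)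
  rw [hrep, h4, map_smul]
  rfl

theorem IsGloballyHypoelliptic.finrank_eq_one [ConnectedSpace M]
    (hGH : IsGloballyHypoelliptic k n M) :
    Module.finrank ℝ (⨅ i : Fin k, kerLieDeriv k n M i : Submodule ℝ (Distribution n M)) = 1 := by
  obtain ⟨x⟩ := (inferInstance : Nonempty M)
  have hmem : orbitDistribution k n x ∈
      (⨅ i : Fin k, kerLieDeriv k n M i : Submodule ℝ (Distribution n M)) :=
    (Submodule.mem_iInf _).2 fun i f => orbitMean_lieDeriv x i f
  refine _root_.finrank_eq_one (⟨_, hmem⟩ :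
    (⨅ i : Fin k, kerLieDeriv k n M i : Submodule ℝ (Distribution n M))) (fun h0 => ?_) fun D => ?_
  · have h1 : orbitDistribution k n x = 0 := congrArg Subtype.val h0
    have h2 := orbitMean_one (k := k) (n := n) x
    have h3 : orbitMean k n x 1 = 0 := congrArg (fun D : Distribution n M => D 1) h1
    rw [h3] at h2
    exact zero_ne_one h2
  · obtain ⟨r, hr⟩ := hGH.exists_eq_smul x (D := D.1)
      fun i f => (Submodule.mem_iInf _).1 D.2 i f
    exact ⟨r, Subtype.ext hr⟩

end Invariant

/-! ### From invariant densities to invariant forms -/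

section InvariantForms

variable {k n : ℕ} {M : Type*} [TopologicalSpace M] [ChartedSpace (EuclideanSpace ℝ (Fin n)) M]
  {μ : ∀ x : M, (Fin n → TangentSpace (𝓡 n) x) → ℝ}

theorem IsSmoothDensity.isActionInvariant [AddAction (EuclideanSpace ℝ (Fin k)) M]
    (hμ : IsSmoothDensity μ)
    (hinv : ∀ (b : EuclideanSpace ℝ (Fin k)) (x : M),
      |mapJac n (fun z : M => b +ᵥ z) x| * frameValue μ (b +ᵥ x) = frameValue μ x) :
    IsActionInvariant k μ := by
  intro a x v
  set w : Fin n → EuclideanSpace ℝ (Fin n) := v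
  set P : EuclideanSpace ℝ (Fin n) →L[ℝ] EuclideanSpace ℝ (Fin n) :=
    mfderiv (𝓡 n) (𝓡 n) (fun z : M => a +ᵥ z) x
  have h1 := hμ.apply_eq (a +ᵥ x) (fun j => (P : EuclideanSpace ℝ (Fin n) →ₗ[ℝ] _) (w j))
  rw [frameMap_comp, LinearMap.det_comp, abs_mul, mul_right_comm] at h1
  refine h1.trans ?_
  rw [hμ.apply_eq x w, ← hinv a x]
  exact mul_comm _ _

theorem IsSmoothDensity.apply_pos (hμ : IsSmoothDensity μ) (hpos : ∀ x, 0 < frameValue μ x)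
    (x : M) {v : Fin n → TangentSpace (𝓡 n) x} (hv : LinearIndependent ℝ v) : 0 < μ x v := by
  have h := hμ.apply_eq x v
  rw [h]
  exact mul_pos (abs_pos.2 (det_frameMap_ne_zero (n := n) hv)) (hpos x)

/-- The sign of the standard basis of the tangent space at `x`, for the orientation given by the
chart `χ x`. -/
def frameSign (χ : M → OpenPartialHomeomorph M (EuclideanSpace ℝ (Fin n))) (x : M) : SignType :=
  SignType.sign (symmJac (χ x) (χ x x))

/-- The form with absolute value `μ` and with the signs prescribed by `χ`. -/
def signedForm (μ : ∀ x : M, (Fin n → TangentSpace (𝓡 n) x) → ℝ)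
    (χ : M → OpenPartialHomeomorph M (EuclideanSpace ℝ (Fin n))) (x : M) :
    TangentSpace (𝓡 n) x [⋀^Fin n]→ₗ[ℝ] ℝ :=
  (((frameSign χ x : ℝ) * frameValue μ x) • (EuclideanSpace.basisFun (Fin n) ℝ).toBasis.det :
    EuclideanSpace ℝ (Fin n) [⋀^Fin n]→ₗ[ℝ] ℝ)

theorem signedForm_apply (χ : M → OpenPartialHomeomorph M (EuclideanSpace ℝ (Fin n))) (x : M)
    (v : Fin n → EuclideanSpace ℝ (Fin n)) :
    signedForm μ χ x v =
      ((frameSign χ x : ℝ) * frameValue μ x) * LinearMap.det (frameMap v) := by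
  rw [← basisFun_det_eq]
  rfl

theorem frameMap_comp_single (T : EuclideanSpace ℝ (Fin n) →ₗ[ℝ] EuclideanSpace ℝ (Fin n)) :
    frameMap (fun j => T (EuclideanSpace.single j (1 : ℝ))) = T := by
  refine (EuclideanSpace.basisFun (Fin n) ℝ).toBasis.ext fun j => ?_
  have h : (EuclideanSpace.basisFun (Fin n) ℝ).toBasis j = EuclideanSpace.single j (1 : ℝ) := by
    simp
  rw [h, frameMap_single]

theorem signedForm_chartFrame (χ : M → OpenPartialHomeomorph M (EuclideanSpace ℝ (Fin n))) (c : M)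
    (y : EuclideanSpace ℝ (Fin n)) :
    signedForm μ χ ((chartAt (EuclideanSpace ℝ (Fin n)) c).symm y) (chartFrame c y) =
      ((frameSign χ ((chartAt (EuclideanSpace ℝ (Fin n)) c).symm y) : ℝ) *
        frameValue μ ((chartAt (EuclideanSpace ℝ (Fin n)) c).symm y)) *
        symmJac (chartAt (EuclideanSpace ℝ (Fin n)) c) y := by
  set T : EuclideanSpace ℝ (Fin n) →L[ℝ] EuclideanSpace ℝ (Fin n) :=
    mfderiv (𝓡 n) (𝓡 n) (chartAt (EuclideanSpace ℝ (Fin n)) c).symm y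
  have h := signedForm_apply (μ := μ) χ ((chartAt (EuclideanSpace ℝ (Fin n)) c).symm y)
    (fun j => (T : EuclideanSpace ℝ (Fin n) →ₗ[ℝ] _) (EuclideanSpace.single j (1 : ℝ)))
  rw [frameMap_comp_single] at h
  exact h

theorem signType_mul_self {s : SignType} (h : s ≠ 0) : s * s = 1 := by
  revert s; decide

theorem signType_mul_right_cancel {s t r : SignType} (hr : r ≠ 0) (h : s * r = t * r) : s = t := by
  revert s t r; decide

section Orientation

variable {A : Set (OpenPartialHomeomorph M (EuclideanSpace ℝ (Fin n)))}
  {χ : M → OpenPartialHomeomorph M (EuclideanSpace ℝ (Fin n))}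

/-- Coordinate changes inside `A` have positive determinant, so the sign is independent of which
chart of `A` is used at `x`. -/
theorem sign_symmJac_eq_frameSign (hA : A ⊆ maximalAtlas (𝓡 n) ∞ M)
    (hdet : ∀ φ ∈ A, ∀ ψ ∈ A, ∀ y ∈ φ.target, φ.symm y ∈ ψ.source →
      0 < (fderiv ℝ (fun z => ψ (φ.symm z)) y).det)
    (hχ : ∀ x, χ x ∈ A ∧ x ∈ (χ x).source)
    {φ : OpenPartialHomeomorph M (EuclideanSpace ℝ (Fin n))} (hφ : φ ∈ A) {x : M}
    (hx : x ∈ φ.source) : SignType.sign (symmJac φ (φ x)) = frameSign χ x := by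
  have hs : φ.symm (φ x) ∈ (χ x).source := by
    rw [φ.left_inv hx]
    exact (hχ x).2
  rw [symmJac_eq (hA hφ) (hA (hχ x).1) (φ.map_source hx) hs, sign_mul,
    sign_pos (hdet φ hφ _ (hχ x).1 _ (φ.map_source hx) hs), mul_one, φ.left_inv hx]
  rfl

theorem frameSign_ne_zero (hA : A ⊆ maximalAtlas (𝓡 n) ∞ M)
    (hχ : ∀ x, χ x ∈ A ∧ x ∈ (χ x).source) (x : M) : frameSign χ x ≠ 0 :=
  sign_ne_zero.2 (symmJac_ne_zero (hA (hχ x).1) ((χ x).map_source (hχ x).2))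

/-- Rewrites pointwise signs as the sign of one coordinate determinant, which varies continuously.
It serves with `g` the identity for smoothness of the form, and with `g` a translation for
preservation of orientation. -/
theorem frameSign_mul_sign_mapJac_mul (hA : A ⊆ maximalAtlas (𝓡 n) ∞ M)
    (hdet : ∀ φ ∈ A, ∀ ψ ∈ A, ∀ y ∈ φ.target, φ.symm y ∈ ψ.source →
      0 < (fderiv ℝ (fun z => ψ (φ.symm z)) y).det)
    (hχ : ∀ x, χ x ∈ A ∧ x ∈ (χ x).source)
    {φ ψ : OpenPartialHomeomorph M (EuclideanSpace ℝ (Fin n))} (hφ : φ ∈ A)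
    (hψ : ψ ∈ maximalAtlas (𝓡 n) ∞ M) {g : M → M} (hg : ContMDiff (𝓡 n) (𝓡 n) ∞ g)
    {y : EuclideanSpace ℝ (Fin n)} (hy : y ∈ ψ.target) (hgy : g (ψ.symm y) ∈ φ.source) :
    frameSign χ (g (ψ.symm y)) * SignType.sign (mapJac n g (ψ.symm y)) *
      SignType.sign (symmJac ψ y) =
        SignType.sign (fderiv ℝ (fun z => φ (g (ψ.symm z))) y).det := by
  rw [mul_assoc, ← sign_mul, mapJac_mul_symmJac hψ (hA hφ) hg hy hgy, sign_mul,
    sign_symmJac_eq_frameSign hA hdet hχ hφ hgy, ← mul_assoc,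
    signType_mul_self (frameSign_ne_zero hA hχ _), one_mul]

/-- Near each point the coordinate expression is that of the density times a sign, locally constant
as the sign of a nonvanishing continuous determinant. -/
theorem isSmoothOnFrames_signedForm [IsManifold (𝓡 n) ∞ M] (hμ : IsSmoothDensity μ)
    (hA : A ⊆ maximalAtlas (𝓡 n) ∞ M)
    (hdet : ∀ φ ∈ A, ∀ ψ ∈ A, ∀ y ∈ φ.target, φ.symm y ∈ ψ.source →
      0 < (fderiv ℝ (fun z => ψ (φ.symm z)) y).det)
    (hχ : ∀ x, χ x ∈ A ∧ x ∈ (χ x).source) :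
    IsSmoothOnFrames (fun x => ⇑(signedForm μ χ x)) := by
  intro c y hy
  refine ContDiffAt.contDiffWithinAt ?_
  set ψ := chartAt (EuclideanSpace ℝ (Fin n)) c with hψdef
  have hψ : ψ ∈ maximalAtlas (𝓡 n) ∞ M := chart_mem_maximalAtlas c
  set φ := χ (ψ.symm y)
  have hφ : φ ∈ A := (hχ _).1
  have hgy : ψ.symm y ∈ φ.source := (hχ _).2
  have hd : ContDiffAt ℝ ∞ (fun z => φ (ψ.symm z)) y :=
    contDiffAt_coord hψ (hA hφ) contMDiff_id hy hgy
  have hd0 := det_fderiv_coord_ne_zero hψ (hA hφ) hy hgy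
  have hsign : ∀ᶠ z in 𝓝 y, SignType.sign (fderiv ℝ (fun z => φ (ψ.symm z)) z).det =
      SignType.sign (fderiv ℝ (fun z => φ (ψ.symm z)) y).det := by
    have h := (continuousAt_sign_of_ne_zero hd0).comp (f := fun z =>
      (fderiv ℝ (fun z => φ (ψ.symm z)) z).det) (continuousAt_det_fderiv hd)
    exact h.eventually (eventually_nhds_iff.2 ⟨{_}, fun _ h => h, isOpen_discrete _, rfl⟩)
  have hsm : ContDiffAt ℝ ∞ (fun z =>
      ((SignType.sign (fderiv ℝ (fun z => φ (ψ.symm z)) y).det : SignType) : ℝ) *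
        chartDensity μ c z) y :=
    contDiffAt_const.mul
      ((hμ.contDiffOn_chartDensity c).contDiffAt (ψ.open_target.mem_nhds hy))
  refine hsm.congr_of_eventuallyEq ?_
  filter_upwards [hsign, ψ.open_target.mem_nhds hy,
    (ψ.symm.continuousAt hy).preimage_mem_nhds (φ.open_source.mem_nhds hgy)] with z hz hzt hzs
  have h1 := frameSign_mul_sign_mapJac_mul hA hdet hχ hφ hψ contMDiff_id hzt hzs
  have h2 : frameSign χ (ψ.symm z) * SignType.sign (symmJac ψ z) =
      SignType.sign (fderiv ℝ (fun z => φ (ψ.symm z)) z).det := by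
    have h3 : mapJac n (id : M → M) (ψ.symm z) = 1 := mapJac_id _
    rw [h3, sign_one, mul_one] at h1
    exact h1
  rw [signedForm_chartFrame, hμ.chartDensity_eq, ← hz, ← h2, ← hψdef]
  conv_lhs => rw [← sign_mul_abs (symmJac ψ z)]
  push_cast
  ring

variable [AddAction (EuclideanSpace ℝ (Fin k)) M]
  [ContMDiffVAdd (𝓡 k) (𝓡 n) ∞ (EuclideanSpace ℝ (Fin k)) M]

/-- Joint smoothness in the group element and the point makes the derivative in the point continuous
in the group element. -/
theorem contDiffAt_uncurry_vadd_coord {φ ψ : OpenPartialHomeomorph M (EuclideanSpace ℝ (Fin n))}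
    (hφ : φ ∈ maximalAtlas (𝓡 n) ∞ M) (hψ : ψ ∈ maximalAtlas (𝓡 n) ∞ M)
    {a : EuclideanSpace ℝ (Fin k)} {y : EuclideanSpace ℝ (Fin n)} (hy : y ∈ ψ.target)
    (hay : a +ᵥ ψ.symm y ∈ φ.source) :
    ContDiffAt ℝ ∞ (Function.uncurry fun (b : EuclideanSpace ℝ (Fin k)) z =>
      φ (b +ᵥ ψ.symm z)) (a, y) := by
  have h1 : ContMDiffAt 𝓘(ℝ, EuclideanSpace ℝ (Fin k) × EuclideanSpace ℝ (Fin n)) (𝓡 n) ∞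
      (fun p : EuclideanSpace ℝ (Fin k) × EuclideanSpace ℝ (Fin n) => ψ.symm p.2) (a, y) :=
    (contMDiffAt_symm_of_mem_maximalAtlas hψ hy).comp (a, y)
      (contDiff_snd.contMDiff.contMDiffAt)
  have h2 : ContMDiffAt 𝓘(ℝ, EuclideanSpace ℝ (Fin k) × EuclideanSpace ℝ (Fin n)) (𝓡 k) ∞
      (fun p : EuclideanSpace ℝ (Fin k) × EuclideanSpace ℝ (Fin n) => p.1) (a, y) :=
    contDiff_fst.contMDiff.contMDiffAt
  have h3 := (ContMDiffVAdd.contMDiff_vadd (I := 𝓡 k) (I' := 𝓡 n) (n := ∞)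
    (G := EuclideanSpace ℝ (Fin k)) (M := M)).contMDiffAt.comp (a, y) (h2.prodMk h1)
  exact ((contMDiffAt_of_mem_maximalAtlas hφ hay).comp (a, y) h3).contDiffAt

/-- The action preserves the orientation, as `ℝ^k` is connected. -/
theorem frameSign_vadd_mul_sign_mapJac [IsManifold (𝓡 n) ∞ M]
    (hA : A ⊆ maximalAtlas (𝓡 n) ∞ M)
    (hdet : ∀ φ ∈ A, ∀ ψ ∈ A, ∀ y ∈ φ.target, φ.symm y ∈ ψ.source →
      0 < (fderiv ℝ (fun z => ψ (φ.symm z)) y).det)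
    (hχ : ∀ x, χ x ∈ A ∧ x ∈ (χ x).source) {x : M}
    (hjac : ∀ b : EuclideanSpace ℝ (Fin k), mapJac n (fun z : M => b +ᵥ z) x ≠ 0)
    (b : EuclideanSpace ℝ (Fin k)) :
    frameSign χ (b +ᵥ x) * SignType.sign (mapJac n (fun z : M => b +ᵥ z) x) = frameSign χ x := by
  set ψ := chartAt (EuclideanSpace ℝ (Fin n)) x
  have hψ : ψ ∈ maximalAtlas (𝓡 n) ∞ M := chart_mem_maximalAtlas x
  have hxs : x ∈ ψ.source := mem_chart_source _ x
  have hy : ψ x ∈ ψ.target := ψ.map_source hxs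
  set s : EuclideanSpace ℝ (Fin k) → SignType := fun b =>
    frameSign χ (b +ᵥ x) * SignType.sign (mapJac n (fun z : M => b +ᵥ z) x) with hs
  have hloc : IsLocallyConstant s := by
    refine (IsLocallyConstant.iff_eventually_eq s).2 fun a => ?_
    set φ := χ (a +ᵥ x)
    have hφ : φ ∈ A := (hχ _).1
    have hay : a +ᵥ x ∈ φ.source := (hχ _).2
    have hJ : SignType.sign (symmJac ψ (ψ x)) ≠ 0 := sign_ne_zero.2 (symmJac_ne_zero hψ hy)
    -- With the chart `φ` fixed, the sign at nearby `b` is read from a determinant continuous in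
    -- `b`; the extra factor is nonzero and independent of `b`, so it can be cancelled.
    have hkey : ∀ b : EuclideanSpace ℝ (Fin k), b +ᵥ x ∈ φ.source →
        s b * SignType.sign (symmJac ψ (ψ x)) =
          SignType.sign (fderiv ℝ (fun z => φ (b +ᵥ ψ.symm z)) (ψ x)).det := by
      intro b hb
      have h := frameSign_mul_sign_mapJac_mul hA hdet hχ hφ hψ (contMDiff_vadd_const n b) hy
        (by rw [ψ.left_inv hxs]; exact hb)
      rw [ψ.left_inv hxs] at h
      exact h
    have hd : ContinuousAt (fun b : EuclideanSpace ℝ (Fin k) =>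
        (fderiv ℝ (fun z => φ (b +ᵥ ψ.symm z)) (ψ x)).det) a :=
      ContinuousLinearMap.continuous_det.continuousAt.comp
        ((contDiffAt_uncurry_vadd_coord (hA hφ) hψ hy
          (by rw [ψ.left_inv hxs]; exact hay)).fderiv (m := 0) (g := fun _ => ψ x)
            contDiffAt_const (by simp)).continuousAt
    have hd0 : (fderiv ℝ (fun z => φ (a +ᵥ ψ.symm z)) (ψ x)).det ≠ 0 := by
      rw [← sign_ne_zero, ← hkey a hay]
      exact mul_ne_zero (mul_ne_zero (frameSign_ne_zero hA hχ _) (sign_ne_zero.2 (hjac a))) hJ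
    have hsign := ((continuousAt_sign_of_ne_zero hd0).comp (f := fun b : EuclideanSpace ℝ (Fin k) =>
      (fderiv ℝ (fun z => φ (b +ᵥ ψ.symm z)) (ψ x)).det) hd).eventually
        (eventually_nhds_iff.2 ⟨{_}, fun _ h => h, isOpen_discrete _, rfl⟩)
    have hcont : Continuous (fun b : EuclideanSpace ℝ (Fin k) => b +ᵥ x) :=
      ((ContMDiffVAdd.contMDiff_vadd (I := 𝓡 k) (I' := 𝓡 n) (n := ∞)
        (G := EuclideanSpace ℝ (Fin k)) (M := M)).continuous).comp
        (continuous_id.prodMk continuous_const)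
    filter_upwards [hsign, hcont.continuousAt.preimage_mem_nhds (φ.open_source.mem_nhds hay)]
      with b hb hbs
    refine signType_mul_right_cancel hJ ?_
    rw [hkey a hay, hkey b hbs]
    exact hb
  have h0 : s 0 = frameSign χ x := by
    rw [hs]
    simp only [zero_vadd, mapJac_id, sign_one, mul_one]
  rw [← h0]
  exact hloc.apply_eq_of_preconnectedSpace b 0

theorem isActionInvariant_signedForm [IsManifold (𝓡 n) ∞ M]
    (hpos : ∀ x, 0 < frameValue μ x)
    (hinv : ∀ (b : EuclideanSpace ℝ (Fin k)) (x : M),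
      |mapJac n (fun z : M => b +ᵥ z) x| * frameValue μ (b +ᵥ x) = frameValue μ x)
    (hA : A ⊆ maximalAtlas (𝓡 n) ∞ M)
    (hdet : ∀ φ ∈ A, ∀ ψ ∈ A, ∀ y ∈ φ.target, φ.symm y ∈ ψ.source →
      0 < (fderiv ℝ (fun z => ψ (φ.symm z)) y).det)
    (hχ : ∀ x, χ x ∈ A ∧ x ∈ (χ x).source) :
    IsActionInvariant k (fun x => ⇑(signedForm μ χ x)) := by
  intro a x v
  set w : Fin n → EuclideanSpace ℝ (Fin n) := v
  -- A vanishing Jacobian would make the invariant density zero at `x`.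
  have hjac : ∀ b : EuclideanSpace ℝ (Fin k), mapJac n (fun z : M => b +ᵥ z) x ≠ 0 := by
    intro b hb
    have h := hinv b x
    rw [hb, abs_zero, zero_mul] at h
    exact (hpos x).ne h
  have hsign := frameSign_vadd_mul_sign_mapJac hA hdet hχ hjac a
  set P : EuclideanSpace ℝ (Fin n) →L[ℝ] EuclideanSpace ℝ (Fin n) :=
    mfderiv (𝓡 n) (𝓡 n) (fun z : M => a +ᵥ z) x
  have h1 := signedForm_apply (μ := μ) χ (a +ᵥ x)
    (fun j => (P : EuclideanSpace ℝ (Fin n) →ₗ[ℝ] _) (w j))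
  rw [frameMap_comp, LinearMap.det_comp] at h1
  refine h1.trans ?_
  have h2 : LinearMap.det (P : EuclideanSpace ℝ (Fin n) →ₗ[ℝ] EuclideanSpace ℝ (Fin n)) =
      mapJac n (fun z : M => a +ᵥ z) x := rfl
  refine Eq.trans ?_ (signedForm_apply (μ := μ) χ x w).symm
  rw [h2, ← hsign, ← hinv a x, ← mul_assoc]
  congr 1
  -- Splitting the Jacobian into sign and modulus separates invariance of the orientation from
  -- invariance of the density.
  conv_lhs => rw [← sign_mul_abs (mapJac n (fun z : M => a +ᵥ z) x)]
  push_cast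
  ring

end Orientation

theorem signedForm_ne_zero {χ : M → OpenPartialHomeomorph M (EuclideanSpace ℝ (Fin n))} {x : M}
    (hχ : frameSign χ x ≠ 0) (hμ : frameValue μ x ≠ 0) : signedForm μ χ x ≠ 0 := by
  intro h
  have h1 := signedForm_apply (μ := μ) χ x
    (fun j => (LinearMap.id (R := ℝ) (M := EuclideanSpace ℝ (Fin n)))
      (EuclideanSpace.single j (1 : ℝ)))
  rw [frameMap_comp_single, LinearMap.det_id, mul_one, h] at h1
  have hs : ((frameSign χ x : SignType) : ℝ) ≠ 0 := by
    revert hχ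
    rcases frameSign χ x <;> simp
  exact mul_ne_zero hs hμ h1.symm

end InvariantForms

end LeafwiseGH

end

/-! ### The main theorem -/

theorem proposition2p1 (k n : ℕ) (M : Type*) [TopologicalSpace M] [T2Space M] [CompactSpace M]
    [ConnectedSpace M] [ChartedSpace (EuclideanSpace ℝ (Fin n)) M] [IsManifold (𝓡 n) ∞ M]
    [AddAction (EuclideanSpace ℝ (Fin k)) M]
    [ContMDiffVAdd (𝓡 k) (𝓡 n) ∞ (EuclideanSpace ℝ (Fin k)) M]
    (hGH : LeafwiseGH.IsGloballyHypoelliptic k n M) :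
    -- an invariant smooth nowhere vanishing density (volume form up to sign)
    (∃ μ : ∀ x : M, (Fin n → TangentSpace (𝓡 n) x) → ℝ,
      LeafwiseGH.IsSmoothDensity μ ∧ LeafwiseGH.IsActionInvariant k μ ∧
      ∀ (x : M) (v : Fin n → TangentSpace (𝓡 n) x), LinearIndependent ℝ v → 0 < μ x v) ∧
    -- if `M` is orientable, an invariant smooth nowhere vanishing `n`-form
    (LeafwiseGH.IsOrientable n M →
      ∃ η : ∀ x : M, TangentSpace (𝓡 n) x [⋀^Fin n]→ₗ[ℝ] ℝ,
        LeafwiseGH.IsSmoothOnFrames (fun x => ⇑(η x)) ∧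
        LeafwiseGH.IsActionInvariant k (fun x => ⇑(η x)) ∧
        ∀ x : M, η x ≠ 0) ∧
    -- the space of invariant distributions is one-dimensional
    Module.finrank ℝ (⨅ i : Fin k, LeafwiseGH.kerLieDeriv k n M i :
      Submodule ℝ (LeafwiseGH.Distribution n M)) = 1 := by
  obtain ⟨x⟩ := (inferInstance : Nonempty M)
  obtain ⟨μ, hμ⟩ := hGH.exists_isRepresentedBy_orbitMean x
  have hpos := hGH.frameValue_pos hμ
  have hinv := fun b => hμ.abs_mapJac_mul_frameValue b (LeafwiseGH.orbitMean_translate x b)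
  refine ⟨⟨μ, hμ.1, hμ.1.isActionInvariant hinv, fun x v hv => hμ.1.apply_pos hpos x hv⟩,
    ?_, hGH.finrank_eq_one⟩
  rintro ⟨A, hA, hcov, hdet⟩
  -- The oriented charts are chosen point by point with no regularity in the point; the resulting
  -- sign does not depend on the choice.
  choose χ hχ using hcov
  exact ⟨LeafwiseGH.signedForm μ χ, LeafwiseGH.isSmoothOnFrames_signedForm hμ.1 hA hdet hχ,
    LeafwiseGH.isActionInvariant_signedForm hpos hinv hA hdet hχ, fun z =>
    LeafwiseGH.signedForm_ne_zero (LeafwiseGH.frameSign_ne_zero hA hχ z) (hpos z).ne'⟩
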